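/- (Koltchinskii–Lounici) There are universal constants $c,C>0$ such that the following holds. Let $d,n\ge 1$ be integers, let $\Sigma$ be a real symmetric positive semidefinite $d\times d$ matrix, let $X_1,\dots,X_n$ be i.i.d. centered Gaussian random vectors in $\mathbb{R}^d$ with covariance matrix $\Sigma$, and let $Z=\frac1n\sum_{k=1}^n X_kX_k^{T}$ be their sample covariance matrix. Write $\|\cdot\|$ for the spectral norm (largest singular value) of a matrix, and let $r(\Sigma)=\operatorname{Tr}\Sigma/\|\Sigma\|$ be the effective rank of $\Sigma$ (with $r(0)=0$). Then $\|Z-\Sigma\|$ is integrable and $$ c\,\|\Sigma\|\left(\sqrt{\frac{r(\Sigma)}{n}}+\frac{r(\Sigma)}{n}\right)\;\le\;\mathbf{E}\|Z-\Sigma\|\;\le\; C\,\|\Sigma\|\left(\sqrt{\frac{r(\Sigma)}{n}}+\frac{r(\Sigma)}{n}\right). $$ -/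

import Mathlib

-- `‖A‖` for a matrix `A` is the spectral norm (the largest singular value)
open scoped Matrix.Norms.L2Operator

/-- The sample covariance matrix `(1/n) ∑ₖ xₖ xₖᵀ` of the vectors `x₁, …, xₙ` in `ℝᵈ`. -/
noncomputable def sampleCovariance {d n : ℕ} (x : Fin n → EuclideanSpace ℝ (Fin d)) :
    Matrix (Fin d) (Fin d) ℝ :=
  (1 / (n : ℝ)) • ∑ k, Matrix.vecMulVec (x k).ofLp (x k).ofLp

/-- The effective rank `r(S) = Tr S / ‖S‖`, where `‖S‖` is the spectral norm
(and `r(0) = 0` by convention). -/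
noncomputable def effectiveRank {d : ℕ} (S : Matrix (Fin d) (Fin d) ℝ) : ℝ :=
  S.trace / ‖S‖

open MeasureTheory ProbabilityTheory ContinuousLinearMap
open scoped ENNReal RealInnerProductSpace
open InnerProductSpace (rankOne rankOne_apply)

/-! ### Gaussian translation and a variational lower bound for exponential moments -/

section GaussianShift

/-! Write `Q` for the operator of `Σ`, `s = ‖Σ‖`, `t = Tr Σ` and `w = √s √(n t)`. After
multiplication by `n`, the claim is that `E‖∑ xₖxₖᵀ - n Q‖` is comparable to `w + t`.

Symmetrization and decoupling: comparing `x` with an independent copy `y` costs at most a factor 2.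
The pair `(x, y)` is invariant under rotation by `π/4`, which turns `∑ (xₖxₖᵀ - yₖyₖᵀ)` into `∑
(xₖyₖᵀ + yₖxₖᵀ)`, linear in `x` once `y` is frozen (`integral_norm_sub_eq_integral_norm_add`).

Upper bound: Chevet's inequality (`integral_norm_sum_rankOne_le`) is applied conditionally on `y`,
then once more to the operator norm of `y` that it produces. Chevet itself is proved by a PAC-Bayes
argument instead of Gaussian comparison: the bilinear form is averaged over Gaussian perturbations
of the test vectors `(u, v)`; by Cameron–Martin, recentring these perturbations costs only `‖h‖²/2`,
and one exponential moment controls all `(u, v)` at once.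

Lower bound: test the decoupled operator on a top eigenvector `bᵢ`. Given `y`, each coordinate along
`bⱼ` is Gaussian in `x` with variance at least `λⱼ ∑ₖ ⟪bᵢ, yₖ⟫²`; summing with weights `√λⱼ` gives
order `w` (`le_integral_norm_sum_rankOne_sub`). A single summand gives `t - n s`
(`integral_norm_sq_sub_le`), which takes over when `t` is large compared with `n s`. -/

lemma lintegral_gaussianReal_shift (h : ℝ) {F : ℝ → ℝ≥0∞} (hF : Measurable F) :
    ∫⁻ x, F (x + h) * ENNReal.ofReal (Real.exp (-(h * x) - h ^ 2 / 2)) ∂(gaussianReal 0 1) =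
      ∫⁻ x, F x ∂(gaussianReal 0 1) := by
  have hv : (1 : NNReal) ≠ 0 := one_ne_zero
  rw [gaussianReal_of_var_ne_zero _ hv,
    lintegral_withDensity_eq_lintegral_mul _ (measurable_gaussianPDF 0 1) (by fun_prop),
    lintegral_withDensity_eq_lintegral_mul _ (measurable_gaussianPDF 0 1) hF,
    ← lintegral_add_right_eq_self (μ := volume) (gaussianPDF 0 1 * F) h]
  refine lintegral_congr fun x => ?_
  have : gaussianPDF 0 1 (x + h) =
      gaussianPDF 0 1 x * ENNReal.ofReal (Real.exp (-(h * x) - h ^ 2 / 2)) := by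
    rw [gaussianPDF, gaussianPDF, ← ENNReal.ofReal_mul (gaussianPDFReal_nonneg _ _ _),
      gaussianPDFReal, gaussianPDFReal, mul_assoc _ (Real.exp _) (Real.exp _), ← Real.exp_add]
    congr 3
    simp only [NNReal.coe_one]
    ring
  simp only [Pi.mul_apply, this]
  ring

lemma lintegral_pi_gaussianReal_shift {ι : Type*} [Fintype ι] (h : ι → ℝ)
    {F : (ι → ℝ) → ℝ≥0∞} (hF : Measurable F) :
    ∫⁻ x, F (x + h) * ENNReal.ofReal (Real.exp (-(∑ i, h i * x i) - (∑ i, h i ^ 2) / 2))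
        ∂(Measure.pi fun _ => gaussianReal 0 1) =
      ∫⁻ x, F x ∂(Measure.pi fun _ => gaussianReal 0 1) := by
  set γ : Measure (ι → ℝ) := Measure.pi fun _ => gaussianReal 0 1 with hγ
  let w : ι → ℝ → ℝ≥0∞ := fun i x => ENNReal.ofReal (Real.exp (-(h i * x) - h i ^ 2 / 2))
  have hw : ∀ i, Measurable (w i) := fun i => by fun_prop
  have hprod (x : ι → ℝ) : ENNReal.ofReal (Real.exp (-(∑ i, h i * x i) - (∑ i, h i ^ 2) / 2)) =
      ∏ i, w i (x i) := by
    rw [← ENNReal.ofReal_prod_of_nonneg fun i _ => (Real.exp_pos _).le, ← Real.exp_sum,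
      Finset.sum_sub_distrib, Finset.sum_neg_distrib, Finset.sum_div]
  simp_rw [hprod]
  have hW : Measurable fun x : ι → ℝ => ∏ i, w i (x i) :=
    Finset.measurable_prod _ fun i _ => (hw i).comp (measurable_pi_apply i)
  have hmeas : Measurable fun x : ι → ℝ => x + h := measurable_add_const h
  -- It suffices to compare the two measures on boxes, where independence factors the integral into
  -- one-dimensional shifts.
  have key : γ = (γ.withDensity fun x => ∏ i, w i (x i)).map (· + h) := by
    refine Measure.pi_eq fun s hs => ?_
    rw [Measure.map_apply hmeas (MeasurableSet.univ_pi hs),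
      withDensity_apply _ (hmeas (MeasurableSet.univ_pi hs)),
      ← lintegral_indicator (hmeas (MeasurableSet.univ_pi hs))]
    let g : ι → ℝ → ℝ≥0∞ := fun i x => (s i).indicator 1 (x + h i) * w i x
    have hg : ∀ i, Measurable (g i) := fun i =>
      ((measurable_one.indicator (hs i)).comp (measurable_add_const _)).mul (hw i)
    have : ∀ x : ι → ℝ, ((fun x => x + h) ⁻¹' Set.univ.pi s).indicator
        (fun x => ∏ i, w i (x i)) x = ∏ i, g i (x i) := by
      intro x
      by_cases hx : x + h ∈ Set.univ.pi s
      · rw [Set.indicator_of_mem (by exact hx)]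
        refine Finset.prod_congr rfl fun i _ => ?_
        have : x i + h i ∈ s i := hx i trivial
        simp [g, this]
      · rw [Set.indicator_of_notMem (by exact hx)]
        have : ∃ i, x i + h i ∉ s i := by simpa [Set.mem_pi] using hx
        obtain ⟨i, hi⟩ := this
        exact (Finset.prod_eq_zero (Finset.mem_univ i) (by simp [g, hi])).symm
    simp_rw [this]
    have hind : iIndepFun (fun i (x : ι → ℝ) => g i (x i)) γ :=
      iIndepFun_pi fun i => (hg i).aemeasurable
    rw [lintegral_prod_eq_prod_lintegral_of_indepFun _ _ hind
      fun i => (hg i).comp (measurable_pi_apply i)]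
    refine Finset.prod_congr rfl fun i _ => ?_
    have := (measurePreserving_eval (fun _ : ι => gaussianReal 0 1) i).lintegral_comp (hg i)
    rw [hγ]
    refine this.trans ?_
    have := lintegral_gaussianReal_shift (h i) (F := (s i).indicator 1)
      (measurable_one.indicator (hs i))
    refine this.trans ?_
    simp [lintegral_indicator_one (hs i)]
  conv_rhs => rw [key]
  rw [lintegral_map hF hmeas, lintegral_withDensity_eq_lintegral_mul _ hW (by fun_prop)]
  refine lintegral_congr fun x => ?_
  simp [mul_comm]

variable {E : Type*} [NormedAddCommGroup E] [InnerProductSpace ℝ E] [FiniteDimensional ℝ E]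
  [MeasurableSpace E] [BorelSpace E]

/-- The **Cameron–Martin formula** for the standard Gaussian measure. -/
lemma lintegral_stdGaussian_shift (h : E) {F : E → ℝ≥0∞} (hF : Measurable F) :
    ∫⁻ x, F (x + h) * ENNReal.ofReal (Real.exp (-⟪h, x⟫ - ‖h‖ ^ 2 / 2)) ∂(stdGaussian E) =
      ∫⁻ x, F x ∂(stdGaussian E) := by
  set b := stdOrthonormalBasis ℝ E
  have hmeas : Measurable fun x : Fin (Module.finrank ℝ E) → ℝ => ∑ i, x i • b i := by fun_prop
  rw [stdGaussian_eq_map_pi_orthonormalBasis b, lintegral_map (by fun_prop) hmeas,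
    lintegral_map hF hmeas,
    ← lintegral_pi_gaussianReal_shift (fun i => ⟪b i, h⟫)
      (F := fun x => F (∑ i, x i • b i)) (by fun_prop)]
  refine lintegral_congr fun x => ?_
  have h1 : ∑ i, (x + fun i => ⟪b i, h⟫) i • b i = ∑ i, x i • b i + h := by
    simp_rw [Pi.add_apply, add_smul, Finset.sum_add_distrib, b.sum_repr']
  have h2 : ⟪h, ∑ i, x i • b i⟫ = ∑ i, ⟪b i, h⟫ * x i := by
    rw [inner_sum]
    refine Finset.sum_congr rfl fun i _ => ?_
    rw [real_inner_smul_right, real_inner_comm, mul_comm]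
  rw [h1, h2, b.sum_sq_inner_right]

/-- A lower bound for the exponential moment of `f`, uniform over the translations of `f`. -/
lemma ofReal_integral_shift_le_lintegral_exp {F : Type*} [NormedAddCommGroup F]
    [InnerProductSpace ℝ F] [FiniteDimensional ℝ F] [MeasurableSpace F] [BorelSpace F]
    {f : E × F → ℝ} (hf : Measurable f) (h : E) (k : F)
    (hi : Integrable (fun z : E × F => f (z + (h, k))) ((stdGaussian E).prod (stdGaussian F))) :
    ENNReal.ofReal (1 + ∫ z, f (z + (h, k)) ∂((stdGaussian E).prod (stdGaussian F))
        - ‖h‖ ^ 2 / 2 - ‖k‖ ^ 2 / 2) ≤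
      ∫⁻ z, ENNReal.ofReal (Real.exp (f z)) ∂((stdGaussian E).prod (stdGaussian F)) := by
  set γ := (stdGaussian E).prod (stdGaussian F) with hγ
  have hE : Integrable (fun z : E × F => ⟪h, z.1⟫) γ :=
    (IsGaussian.integrable_dual (stdGaussian E) (innerSL ℝ h)).comp_fst _
  have hF : Integrable (fun z : E × F => ⟪k, z.2⟫) γ :=
    (IsGaussian.integrable_dual (stdGaussian F) (innerSL ℝ k)).comp_snd _
  have hE0 : ∫ z, ⟪h, z.1⟫ ∂γ = 0 := by
    rw [hγ, integral_fun_fst (f := fun x : E => ⟪h, x⟫)]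
    simpa using integral_strongDual_stdGaussian (innerSL ℝ h)
  have hF0 : ∫ z, ⟪k, z.2⟫ ∂γ = 0 := by
    rw [hγ, integral_fun_snd (f := fun x : F => ⟪k, x⟫)]
    simpa using integral_strongDual_stdGaussian (innerSL ℝ k)
  let g : E × F → ℝ := fun z =>
    f (z + (h, k)) + (-⟪h, z.1⟫ - ‖h‖ ^ 2 / 2) + (-⟪k, z.2⟫ - ‖k‖ ^ 2 / 2)
  have hgi : Integrable (fun z => 1 + g z) γ := by
    refine (integrable_const _).add ((hi.add ?_).add ?_)
    · exact hE.neg.sub (integrable_const _)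
    · exact hF.neg.sub (integrable_const _)
  have hg : ∫ z, 1 + g z ∂γ = 1 + ∫ z, f (z + (h, k)) ∂γ - ‖h‖ ^ 2 / 2 - ‖k‖ ^ 2 / 2 := by
    have e : ∀ z, 1 + g z = f (z + (h, k)) - ⟪h, z.1⟫ - ⟪k, z.2⟫
        + (1 - ‖h‖ ^ 2 / 2 - ‖k‖ ^ 2 / 2) := fun z => by simp only [g]; ring
    simp_rw [e]
    rw [integral_add ?_ (integrable_const _), integral_sub ?_ hF,
      integral_sub hi hE, hE0, hF0, integral_const]
    rotate_left
    · exact hi.sub hE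
    · exact (hi.sub hE).sub hF
    simp
    ring
  have hshift : ∫⁻ z, ENNReal.ofReal (Real.exp (f z)) ∂γ =
      ∫⁻ z, ENNReal.ofReal (Real.exp (g z)) ∂γ := by
    rw [hγ, lintegral_prod _ (by fun_prop), lintegral_prod _ (by fun_prop),
      ← lintegral_stdGaussian_shift h (by fun_prop)]
    refine lintegral_congr fun x => ?_
    rw [← lintegral_stdGaussian_shift k (by fun_prop), ← lintegral_mul_const _ (by fun_prop)]
    refine lintegral_congr fun y => ?_
    rw [← ENNReal.ofReal_mul (by positivity), ← ENNReal.ofReal_mul (by positivity),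
      ← Real.exp_add, ← Real.exp_add]
    simp only [g, Prod.mk_add_mk]
    congr 2
    ring
  rw [hshift, ← hg]
  -- The inequality `1 + g ≤ exp g` gives a logarithm-free Gibbs variational bound, linear in `f`
  -- and so ready to be integrated over further randomness.
  calc ENNReal.ofReal (∫ z, 1 + g z ∂γ)
      ≤ ENNReal.ofReal (∫ z, max (1 + g z) 0 ∂γ) :=
        ENNReal.ofReal_le_ofReal (integral_mono hgi hgi.pos_part fun z => le_max_left _ _)
    _ = ∫⁻ z, ENNReal.ofReal (max (1 + g z) 0) ∂γ :=
        ofReal_integral_eq_lintegral_ofReal hgi.pos_part (.of_forall fun z => le_max_right _ _)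
    _ ≤ _ := by
        refine lintegral_mono fun z => ENNReal.ofReal_le_ofReal (max_le ?_ (Real.exp_pos _).le)
        linarith [Real.add_one_le_exp (g z)]

end GaussianShift

/-! ### Chevet's inequality by Gaussian smoothing -/

section GaussianOperator

variable {E : Type*} [NormedAddCommGroup E] [InnerProductSpace ℝ E] [FiniteDimensional ℝ E]
  [MeasurableSpace E] [BorelSpace E]
  {F : Type*} [NormedAddCommGroup F] [InnerProductSpace ℝ F] [FiniteDimensional ℝ F]
  [MeasurableSpace F] [BorelSpace F]

omit [FiniteDimensional ℝ E] in
lemma memLp_inner_of_isGaussian (μ : Measure E) [IsGaussian μ] (a : E) :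
    MemLp (fun x => ⟪a, x⟫) 2 μ :=
  IsGaussian.memLp_dual μ (innerSL ℝ a) 2 (by simp)

omit [FiniteDimensional ℝ E] in
lemma integrable_inner_of_isGaussian (μ : Measure E) [IsGaussian μ] (a : E) :
    Integrable (fun x => ⟪a, x⟫) μ :=
  IsGaussian.integrable_dual μ (innerSL ℝ a)

omit [FiniteDimensional ℝ E] in
lemma integrable_inner_sq_of_isGaussian (μ : Measure E) [IsGaussian μ] (a : E) :
    Integrable (fun x => ⟪a, x⟫ ^ 2) μ :=
  (memLp_inner_of_isGaussian μ a).integrable_sq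

lemma integral_inner_of_integral_eq_zero {μ : Measure E} [IsGaussian μ] (hμ : ∫ x, x ∂μ = 0)
    (a : E) : ∫ x, ⟪a, x⟫ ∂μ = 0 := by
  rw [integral_inner (f := fun x => x) IsGaussian.integrable_id, hμ, inner_zero_right]

lemma integrable_inner_add_smul_stdGaussian (w u : E) (σ : ℝ) :
    Integrable (fun x => ⟪w, u + σ • x⟫) (stdGaussian E) := by
  simp_rw [inner_add_right, real_inner_smul_right]
  exact (integrable_const _).add ((integrable_inner_of_isGaussian _ w).const_mul σ)

lemma integral_inner_add_smul_stdGaussian (w u : E) (σ : ℝ) :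
    ∫ x, ⟪w, u + σ • x⟫ ∂(stdGaussian E) = ⟪w, u⟫ := by
  have h : Integrable (fun x => σ * ⟪w, x⟫) (stdGaussian E) :=
    (integrable_inner_of_isGaussian _ w).const_mul σ
  simp_rw [inner_add_right, real_inner_smul_right]
  rw [integral_add (integrable_const _) h, integral_const_mul,
    integral_inner_of_integral_eq_zero integral_id_stdGaussian]
  simp

lemma integrable_inner_add_smul_sq_stdGaussian (w u : E) (σ : ℝ) :
    Integrable (fun x => ⟪w, u + σ • x⟫ ^ 2) (stdGaussian E) := by
  have h : MemLp (fun x => ⟪w, u⟫ + σ * ⟪w, x⟫) 2 (stdGaussian E) :=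
    (memLp_const ⟪w, u⟫).add ((memLp_inner_of_isGaussian _ w).const_mul σ)
  simp_rw [inner_add_right, real_inner_smul_right]
  exact h.integrable_sq

lemma integral_inner_sq_stdGaussian (w : E) :
    ∫ x, ⟪w, x⟫ ^ 2 ∂(stdGaussian E) = ‖w‖ ^ 2 := by
  have h := variance_dual_stdGaussian (innerSL ℝ w)
  rw [variance_of_integral_eq_zero (by fun_prop) (integral_strongDual_stdGaussian _)] at h
  simpa using h

lemma integral_inner_add_smul_sq_stdGaussian (w u : E) (σ : ℝ) :
    ∫ x, ⟪w, u + σ • x⟫ ^ 2 ∂(stdGaussian E) = ⟪w, u⟫ ^ 2 + σ ^ 2 * ‖w‖ ^ 2 := by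
  have h1 : Integrable (fun x => 2 * ⟪w, u⟫ * σ * ⟪w, x⟫) (stdGaussian E) :=
    (integrable_inner_of_isGaussian _ w).const_mul _
  have h2 : Integrable (fun x => σ ^ 2 * ⟪w, x⟫ ^ 2) (stdGaussian E) :=
    (integrable_inner_sq_of_isGaussian _ w).const_mul _
  have h3 : Integrable (fun x => ⟪w, u⟫ ^ 2 + 2 * ⟪w, u⟫ * σ * ⟪w, x⟫) (stdGaussian E) :=
    (integrable_const _).add h1
  have e : ∀ x, ⟪w, u + σ • x⟫ ^ 2 = ⟪w, u⟫ ^ 2 + 2 * ⟪w, u⟫ * σ * ⟪w, x⟫ + σ ^ 2 * ⟪w, x⟫ ^ 2 :=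
    fun x => by rw [inner_add_right, real_inner_smul_right]; ring
  simp_rw [e]
  rw [integral_add h3 h2, integral_add (integrable_const _) h1, integral_const_mul,
    integral_const_mul, integral_inner_of_integral_eq_zero integral_id_stdGaussian,
    integral_inner_sq_stdGaussian]
  simp

lemma lintegral_exp_gaussianReal (v : NNReal) :
    ∫⁻ t, ENNReal.ofReal (Real.exp t) ∂(gaussianReal 0 v) = ENNReal.ofReal (Real.exp (v / 2)) := by
  have h := congrFun (mgf_fun_id_gaussianReal (μ := 0) (v := v)) 1
  have hi := integrable_exp_mul_gaussianReal (μ := 0) (v := v) 1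
  simp only [mgf, one_mul] at h hi
  rw [← ofReal_integral_eq_lintegral_ofReal hi (.of_forall fun _ => (Real.exp_pos _).le), h]
  simp

instance isGaussian_pi {ι : Type*} [Fintype ι] (μ : Measure E) [IsGaussian μ] :
    IsGaussian (Measure.pi fun _ : ι => μ) := by
  have h : iIndepFun (fun (k : ι) (x : ι → E) => x k) (Measure.pi fun _ : ι => μ) :=
    iIndepFun_pi (X := fun _ => id) fun _ => aemeasurable_id
  have := (h.hasGaussianLaw fun k => ⟨by
    rw [(measurePreserving_eval (fun _ : ι => μ) k).map_eq]; infer_instance⟩).isGaussian_map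
  simpa using this

/-- A linear functional of independent centered Gaussian vectors is a centered Gaussian
variable. -/
lemma map_sum_inner_pi {ι : Type*} [Fintype ι] {μ : Measure E} [IsGaussian μ]
    (hμ : ∫ x, x ∂μ = 0) (c : ι → E) :
    (Measure.pi fun _ : ι => μ).map (fun x => ∑ k, ⟪c k, x k⟫) =
      gaussianReal 0 (∑ k, ∫ x, ⟪c k, x⟫ ^ 2 ∂μ).toNNReal := by
  let L : StrongDual ℝ (ι → E) := ∑ k, (innerSL ℝ (c k)).comp (ContinuousLinearMap.proj k)
  have hL : ⇑L = fun x : ι → E => ∑ k, ⟪c k, x k⟫ := by ext x; simp [L]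
  have h0 (k : ι) : ∫ x, ⟪c k, x⟫ ∂μ = 0 := integral_inner_of_integral_eq_zero hμ (c k)
  have hi (k : ι) : Integrable (fun x => ⟪c k, x⟫) μ := integrable_inner_of_isGaussian μ (c k)
  have hmean : ∫ x, L x ∂(Measure.pi fun _ : ι => μ) = 0 := by
    rw [hL, integral_finsetSum]
    · refine Finset.sum_eq_zero fun k _ => ?_
      exact (integral_comp_eval (μ := fun _ : ι => μ) (i := k) (f := fun x => ⟪c k, x⟫)
        (by fun_prop)).trans (h0 k)
    · exact fun k _ => integrable_comp_eval (μ := fun _ : ι => μ) (f := fun x => ⟪c k, x⟫) (hi k)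
  have hvar : Var[L; Measure.pi fun _ : ι => μ] = ∑ k, ∫ x, ⟪c k, x⟫ ^ 2 ∂μ := by
    have : ⇑L = ∑ k, fun x : ι → E => ⟪c k, x k⟫ := by rw [hL]; ext x; simp
    rw [this, variance_sum_pi (X := fun k x => ⟪c k, x⟫)
      fun k => memLp_inner_of_isGaussian μ (c k)]
    exact Finset.sum_congr rfl fun k _ => variance_of_integral_eq_zero (by fun_prop) (h0 k)
  rw [← hL, IsGaussian.map_eq_gaussianReal, hmean, hvar]

omit [FiniteDimensional ℝ E] [MeasurableSpace E] [BorelSpace E] [FiniteDimensional ℝ F]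
  [MeasurableSpace F] [BorelSpace F] in
lemma opNorm_le_of_inner_le {M : F →L[ℝ] E} {C : ℝ}
    (h : ∀ u v, ‖u‖ ≤ 1 → ‖v‖ ≤ 1 → ⟪u, M v⟫ ≤ C) : ‖M‖ ≤ C := by
  have hC : 0 ≤ C := by simpa using h 0 0 (by simp) (by simp)
  refine ContinuousLinearMap.opNorm_le_of_unit_norm hC fun v hv => ?_
  by_cases h0 : M v = 0
  · simpa [h0] using hC
  · have h1 : ‖M v‖ ≠ 0 := norm_ne_zero_iff.2 h0
    have := h (‖M v‖⁻¹ • M v) v (by simp [norm_smul, h1]) hv.le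
    rw [real_inner_smul_left, real_inner_self_eq_norm_sq] at this
    have e : ‖M v‖⁻¹ * ‖M v‖ ^ 2 = ‖M v‖ := by field_simp
    rwa [e] at this

lemma integrable_eval_pi {ι : Type*} [Fintype ι] (μ : Measure E) [IsGaussian μ] (k : ι) :
    Integrable (fun x : ι → E => x k) (Measure.pi fun _ : ι => μ) :=
  integrable_comp_eval (μ := fun _ : ι => μ) (f := id) IsGaussian.integrable_id

omit [FiniteDimensional ℝ F] [MeasurableSpace F] [BorelSpace F] in
lemma integrable_norm_sum_rankOne {ι : Type*} [Fintype ι] (μ : Measure E) [IsGaussian μ]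
    (y : ι → F) :
    Integrable (fun x : ι → E => ‖∑ k, rankOne ℝ (x k) (y k)‖) (Measure.pi fun _ : ι => μ) := by
  refine (integrable_finsetSum _ fun k _ => ?_).norm
  exact ((rankOne ℝ (E := E) (F := F)).flip (y k)).integrable_comp (integrable_eval_pi μ k)

/-- PAC-Bayes proof of Chevet's bound. The parameters `L` and `T` both bound squared quantities, and
positivity allows division by all four parameters. -/
lemma integral_norm_sum_rankOne_le_of_pos {ι κ : Type*} [Fintype ι] [Fintype κ] {μ : Measure E}
    [IsGaussian μ] (hμ : ∫ x, x ∂μ = 0) {w : κ → E}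
    (hw : ∀ a, ∫ x, ⟪a, x⟫ ^ 2 ∂μ = ∑ j, ⟪w j, a⟫ ^ 2) (y : ι → F) {s t L T : ℝ}
    (hs : 0 < s) (ht : 0 < t) (hL : 0 < L) (hT : 0 < T)
    (hws : ∀ a, ∑ j, ⟪w j, a⟫ ^ 2 ≤ s * ‖a‖ ^ 2) (hwt : ∑ j, ‖w j‖ ^ 2 ≤ t)
    (hyL : ∀ b, ∑ k, ⟪y k, b⟫ ^ 2 ≤ L * ‖b‖ ^ 2) (hyT : ∑ k, ‖y k‖ ^ 2 ≤ T) :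
    ∫ x, ‖∑ k, rankOne ℝ (x k) (y k)‖ ∂(Measure.pi fun _ : ι => μ) ≤ 2 * √(t * L + s * T) := by
  set π := Measure.pi fun _ : ι => μ with hπ
  set γ := (stdGaussian E).prod (stdGaussian F) with hγ
  -- The smoothing scales balance signal and noise: `σ² t = s` and `τ² T = L`, so averaging at most
  -- doubles the bounds `s` and `L`.
  obtain ⟨σ, hσ, hσ2⟩ : ∃ σ : ℝ, 0 < σ ∧ σ ^ 2 = s / t :=
    ⟨√(s / t), by positivity, Real.sq_sqrt (by positivity)⟩
  obtain ⟨τ, hτ, hτ2⟩ : ∃ τ : ℝ, 0 < τ ∧ τ ^ 2 = L / T :=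
    ⟨√(L / T), by positivity, Real.sq_sqrt (by positivity)⟩
  set R := √(t * L + s * T) with hR
  have hR0 : 0 < R := by positivity
  have hR2 : R ^ 2 = t * L + s * T := Real.sq_sqrt (by positivity)
  -- This `l` minimizes `K / l` for the total cost `K` below, with minimum `2 * R`.
  set l := R / (2 * (s * L)) with hl
  have hl0 : 0 < l := by positivity
  -- The subtracted term is half the variance in `x` of the linear term, so `exp (G x z)` has mean
  -- one for each `z`.
  let G : (ι → E) → E × F → ℝ := fun x z => l * ∑ k, ⟪x k, z.1⟫ * ⟪y k, z.2⟫
    - l ^ 2 / 2 * ((∑ j, ⟪w j, z.1⟫ ^ 2) * ∑ k, ⟪y k, z.2⟫ ^ 2)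
  let f : (ι → E) → E × F → ℝ := fun x z => G x (σ • z.1, τ • z.2)
  have hGm : Measurable fun p : (ι → E) × (E × F) => G p.1 p.2 := by
    have : Continuous fun p : (ι → E) × (E × F) => G p.1 p.2 := by
      simp only [G]
      fun_prop
    exact this.measurable
  have hfm : Measurable fun p : (ι → E) × (E × F) => f p.1 p.2 :=
    hGm.comp (f := fun p : (ι → E) × (E × F) => (p.1, (σ • p.2.1, τ • p.2.2))) (by fun_prop)
  have hmgf (z : E × F) : ∫⁻ x, ENNReal.ofReal (Real.exp (G x z)) ∂π = 1 := by
    have e (x : ι → E) : G x z = ∑ k, ⟪(l * ⟪y k, z.2⟫) • z.1, x k⟫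
        + -(l ^ 2 / 2 * ((∑ j, ⟪w j, z.1⟫ ^ 2) * ∑ k, ⟪y k, z.2⟫ ^ 2)) := by
      simp only [G, Finset.mul_sum, sub_eq_add_neg]
      congr 1
      refine Finset.sum_congr rfl fun k _ => ?_
      rw [real_inner_smul_left, real_inner_comm]
      ring
    simp_rw [e, Real.exp_add, ENNReal.ofReal_mul (Real.exp_pos _).le]
    rw [lintegral_mul_const _ (by fun_prop),
      ← lintegral_map (f := fun t : ℝ => ENNReal.ofReal (Real.exp t))
        (g := fun x : ι → E => ∑ k, ⟪(l * ⟪y k, z.2⟫) • z.1, x k⟫) (by fun_prop) (by fun_prop),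
      map_sum_inner_pi hμ, lintegral_exp_gaussianReal, ← ENNReal.ofReal_mul (Real.exp_pos _).le,
      ← Real.exp_add]
    have hv : ∑ k, ∫ x, ⟪(l * ⟪y k, z.2⟫) • z.1, x⟫ ^ 2 ∂μ =
        l ^ 2 * ((∑ j, ⟪w j, z.1⟫ ^ 2) * ∑ k, ⟪y k, z.2⟫ ^ 2) := by
      simp_rw [real_inner_smul_left, mul_pow, integral_const_mul, hw, Finset.mul_sum]
      exact Finset.sum_congr rfl fun k _ => by rw [← Finset.mul_sum]; ring
    rw [hv, Real.coe_toNNReal _ (by positivity)]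
    ring_nf
    simp
  have hshift (x : ι → E) (u : E) (v : F) (z : E × F) :
      f x (z + (σ⁻¹ • u, τ⁻¹ • v)) = G x (u + σ • z.1, v + τ • z.2) := by
    simp only [f, Prod.fst_add, Prod.snd_add, smul_add, smul_inv_smul₀ hσ.ne',
      smul_inv_smul₀ hτ.ne', add_comm]
  have hint (x : ι → E) (u : E) (v : F) :
      Integrable (fun z : E × F => G x (u + σ • z.1, v + τ • z.2)) γ ∧
      ∫ z, G x (u + σ • z.1, v + τ • z.2) ∂γ =
        l * ⟪u, (∑ k, rankOne ℝ (x k) (y k)) v⟫ - l ^ 2 / 2 *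
          ((∑ j, ⟪w j, u⟫ ^ 2 + σ ^ 2 * ∑ j, ‖w j‖ ^ 2) *
          (∑ k, ⟪y k, v⟫ ^ 2 + τ ^ 2 * ∑ k, ‖y k‖ ^ 2)) := by
    have i1 (k : ι) : Integrable (fun z : E × F => ⟪x k, u + σ • z.1⟫ * ⟪y k, v + τ • z.2⟫) γ :=
      (integrable_inner_add_smul_stdGaussian (x k) u σ).mul_prod
        (integrable_inner_add_smul_stdGaussian (y k) v τ)
    have i2 : Integrable (fun z : E × F => (∑ j, ⟪w j, u + σ • z.1⟫ ^ 2) *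
        ∑ k, ⟪y k, v + τ • z.2⟫ ^ 2) γ :=
      (integrable_finsetSum _ fun j _ => integrable_inner_add_smul_sq_stdGaussian
        (w j) u σ).mul_prod (f := fun z : E => ∑ j, ⟪w j, u + σ • z⟫ ^ 2)
        (g := fun z : F => ∑ k, ⟪y k, v + τ • z⟫ ^ 2)
        (integrable_finsetSum _ fun k _ => integrable_inner_add_smul_sq_stdGaussian (y k) v τ)
    have i1' := (integrable_finsetSum Finset.univ fun k _ => i1 k).const_mul l
    refine ⟨i1'.sub (i2.const_mul _), ?_⟩
    simp only [G]
    rw [integral_sub i1' (i2.const_mul _), integral_const_mul, integral_const_mul,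
      integral_finsetSum _ fun k _ => i1 k, hγ,
      integral_prod_mul (fun z : E => ∑ j, ⟪w j, u + σ • z⟫ ^ 2)
        (fun z : F => ∑ k, ⟪y k, v + τ • z⟫ ^ 2),
      integral_finsetSum _ fun j _ => integrable_inner_add_smul_sq_stdGaussian (w j) u σ,
      integral_finsetSum _ fun k _ => integrable_inner_add_smul_sq_stdGaussian (y k) v τ]
    have i3 (k : ι) : ∫ z, ⟪x k, u + σ • z.1⟫ * ⟪y k, v + τ • z.2⟫
        ∂((stdGaussian E).prod (stdGaussian F)) = ⟪x k, u⟫ * ⟪y k, v⟫ := by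
      rw [integral_prod_mul (fun z : E => ⟪x k, u + σ • z⟫) (fun z : F => ⟪y k, v + τ • z⟫),
        integral_inner_add_smul_stdGaussian, integral_inner_add_smul_stdGaussian]
    simp_rw [i3,
      integral_inner_add_smul_sq_stdGaussian,
      Finset.sum_add_distrib, Finset.mul_sum, sum_apply, inner_sum,
      rankOne_apply, real_inner_smul_right, Finset.mul_sum]
    congr 1
    refine Finset.sum_congr rfl fun k _ => ?_
    rw [real_inner_comm u]
    ring
  -- Smoothed variance at unit vectors plus the price of shifting by `σ⁻¹ • u` and `τ⁻¹ • v`.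
  set K := l ^ 2 / 2 * ((2 * s) * (2 * L)) + (t / s + T / L) / 2 with hK
  let W : (ι → E) → ℝ≥0∞ := fun x => ∫⁻ z, ENNReal.ofReal (Real.exp (f x z)) ∂γ
  have hWint : ∫⁻ x, W x ∂π = 1 := by
    simp only [W]
    rw [lintegral_lintegral_swap (by fun_prop)]
    simp only [f, hmgf]
    simp
  -- `W x` does not involve `u` and `v`, so bounding every bilinear value by it bounds the operator
  -- norm. Since `W` has mean one, integrating yields `l * E‖·‖ ≤ K`.
  have hbound (x : ι → E) :
      ENNReal.ofReal (1 + l * ‖∑ k, rankOne ℝ (x k) (y k)‖ - K) ≤ W x := by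
    by_cases htop : W x = ⊤
    · simp [htop]
    refine ENNReal.ofReal_le_of_le_toReal ?_
    suffices h : ‖∑ k, rankOne ℝ (x k) (y k)‖ ≤ ((W x).toReal - 1 + K) / l by
      rw [le_div_iff₀ hl0] at h
      linarith
    refine opNorm_le_of_inner_le fun u v hu hv => ?_
    have h1 := ofReal_integral_shift_le_lintegral_exp (f := f x) (by fun_prop) (σ⁻¹ • u) (τ⁻¹ • v)
    simp_rw [hshift] at h1
    replace h1 := h1 (hint x u v).1
    rw [(hint x u v).2, ENNReal.ofReal_le_iff_le_toReal htop] at h1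
    have b1 : ∑ j, ⟪w j, u⟫ ^ 2 + σ ^ 2 * ∑ j, ‖w j‖ ^ 2 ≤ 2 * s := by
      have : σ ^ 2 * ∑ j, ‖w j‖ ^ 2 ≤ s / t * t := by rw [hσ2]; gcongr
      have h3 : s * ‖u‖ ^ 2 ≤ s * 1 := by gcongr; exact pow_le_one₀ (norm_nonneg _) hu
      rw [div_mul_cancel₀ _ ht.ne'] at this
      linarith [hws u]
    have b2 : ∑ k, ⟪y k, v⟫ ^ 2 + τ ^ 2 * ∑ k, ‖y k‖ ^ 2 ≤ 2 * L := by
      have : τ ^ 2 * ∑ k, ‖y k‖ ^ 2 ≤ L / T * T := by rw [hτ2]; gcongr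
      have h3 : L * ‖v‖ ^ 2 ≤ L * 1 := by gcongr; exact pow_le_one₀ (norm_nonneg _) hv
      rw [div_mul_cancel₀ _ hT.ne'] at this
      linarith [hyL v]
    have b3 : l ^ 2 / 2 * ((∑ j, ⟪w j, u⟫ ^ 2 + σ ^ 2 * ∑ j, ‖w j‖ ^ 2) *
          (∑ k, ⟪y k, v⟫ ^ 2 + τ ^ 2 * ∑ k, ‖y k‖ ^ 2)) ≤ l ^ 2 / 2 * ((2 * s) * (2 * L)) := by
      gcongr
    have b4 : ‖σ⁻¹ • u‖ ^ 2 ≤ t / s := by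
      rw [norm_smul, mul_pow, norm_inv, Real.norm_of_nonneg hσ.le, inv_pow, hσ2, inv_div]
      exact mul_le_of_le_one_right (by positivity) (pow_le_one₀ (norm_nonneg _) hu)
    have b5 : ‖τ⁻¹ • v‖ ^ 2 ≤ T / L := by
      rw [norm_smul, mul_pow, norm_inv, Real.norm_of_nonneg hτ.le, inv_pow, hτ2, inv_div]
      exact mul_le_of_le_one_right (by positivity) (pow_le_one₀ (norm_nonneg _) hv)
    rw [le_div_iff₀ hl0]
    change _ ≤ (W x).toReal at h1
    linarith
  have hi : Integrable (fun x => ‖∑ k, rankOne ℝ (x k) (y k)‖) π := integrable_norm_sum_rankOne μ y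
  have hi1 : Integrable (fun x => 1 + l * ‖∑ k, rankOne ℝ (x k) (y k)‖) π :=
    (integrable_const _).add (hi.const_mul l)
  have hi2 : Integrable (fun x => 1 + l * ‖∑ k, rankOne ℝ (x k) (y k)‖ - K) π :=
    hi1.sub (integrable_const _)
  have hfin : ENNReal.ofReal (∫ x, (1 + l * ‖∑ k, rankOne ℝ (x k) (y k)‖ - K) ∂π) ≤ 1 := by
    calc _ ≤ ENNReal.ofReal (∫ x, max (1 + l * ‖∑ k, rankOne ℝ (x k) (y k)‖ - K) 0 ∂π) :=
          ENNReal.ofReal_le_ofReal (integral_mono hi2 hi2.pos_part fun z => le_max_left _ _)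
      _ = ∫⁻ x, ENNReal.ofReal (max (1 + l * ‖∑ k, rankOne ℝ (x k) (y k)‖ - K) 0) ∂π :=
          ofReal_integral_eq_lintegral_ofReal hi2.pos_part (.of_forall fun z => le_max_right _ _)
      _ ≤ ∫⁻ x, W x ∂π := lintegral_mono fun x => by
          rw [ENNReal.ofReal_max]
          exact max_le (hbound x) (by simp)
      _ = 1 := hWint
  rw [ENNReal.ofReal_le_one, integral_sub hi1 (integrable_const _),
    integral_add (integrable_const _) (hi.const_mul l),
    integral_const_mul] at hfin
  simp only [integral_const, probReal_univ, smul_eq_mul, one_mul] at hfin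
  have hKl : K = l * (2 * R) := by
    have : t / s + T / L = R ^ 2 / (s * L) := by rw [hR2]; field_simp
    rw [hK, this, hl]
    field_simp
    ring
  refine le_of_mul_le_mul_left ?_ hl0
  linarith

/-- **Chevet's inequality** for a linear combination of independent Gaussian vectors. -/
theorem integral_norm_sum_rankOne_le {ι κ : Type*} [Fintype ι] [Fintype κ] {μ : Measure E}
    [IsGaussian μ] (hμ : ∫ x, x ∂μ = 0) {w : κ → E}
    (hw : ∀ a, ∫ x, ⟪a, x⟫ ^ 2 ∂μ = ∑ j, ⟪w j, a⟫ ^ 2) (y : ι → F) {s L : ℝ}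
    (hs : 0 ≤ s) (hL : 0 ≤ L)
    (hws : ∀ a, ∑ j, ⟪w j, a⟫ ^ 2 ≤ s * ‖a‖ ^ 2)
    (hyL : ∀ b, ∑ k, ⟪y k, b⟫ ^ 2 ≤ L ^ 2 * ‖b‖ ^ 2) :
    ∫ x, ‖∑ k, rankOne ℝ (x k) (y k)‖ ∂(Measure.pi fun _ : ι => μ) ≤
      2 * (√(∑ j, ‖w j‖ ^ 2) * L + √s * √(∑ k, ‖y k‖ ^ 2)) := by
  set t := ∑ j, ‖w j‖ ^ 2
  set T := ∑ k, ‖y k‖ ^ 2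
  have ht : 0 ≤ t := by positivity
  have hT : 0 ≤ T := by positivity
  -- Degenerate parameters are reached by adding `ε` to each and letting it tend to zero.
  have hle (ε : ℝ) (hε : 0 < ε) :=
    integral_norm_sum_rankOne_le_of_pos hμ hw y (s := s + ε) (t := t + ε) (L := L ^ 2 + ε) (T := T + ε)
      (by positivity) (by positivity) (by positivity) (by positivity)
      (fun a => (hws a).trans (by gcongr; linarith)) (by linarith)
      (fun a => (hyL a).trans (by gcongr; linarith)) (by linarith)
  have hlim : Filter.Tendsto (fun ε : ℝ => 2 * √((t + ε) * (L ^ 2 + ε) + (s + ε) * (T + ε)))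
      (nhdsWithin 0 (Set.Ioi 0)) (nhds (2 * √(t * L ^ 2 + s * T))) := by
    have : Continuous fun ε : ℝ => 2 * √((t + ε) * (L ^ 2 + ε) + (s + ε) * (T + ε)) := by fun_prop
    simpa using (this.tendsto 0).mono_left nhdsWithin_le_nhds
  refine (ge_of_tendsto hlim (Filter.eventually_of_mem self_mem_nhdsWithin hle)).trans ?_
  gcongr
  refine Real.sqrt_le_iff.2 ⟨by positivity, ?_⟩
  rw [add_sq, mul_pow, mul_pow, Real.sq_sqrt ht, Real.sq_sqrt hs, Real.sq_sqrt hT]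
  have : 0 ≤ 2 * (√t * L) * (√s * √T) := by positivity
  linarith

end GaussianOperator

/-! ### Symmetrization and decoupling -/

section Symmetrization

/-- Jensen's inequality in the independent copy. -/
lemma integral_norm_sub_integral_le {Ω V : Type*} [MeasurableSpace Ω] {π : Measure Ω}
    [IsProbabilityMeasure π] [NormedAddCommGroup V] [NormedSpace ℝ V] [CompleteSpace V]
    {φ : Ω → V} (hφ : Integrable φ π) :
    ∫ x, ‖φ x - ∫ y, φ y ∂π‖ ∂π ≤ ∫ p, ‖φ p.1 - φ p.2‖ ∂(π.prod π) := by
  have hi : Integrable (fun p : Ω × Ω => φ p.1 - φ p.2) (π.prod π) :=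
    (hφ.comp_fst π).sub (hφ.comp_snd π)
  rw [integral_prod _ hi.norm]
  refine integral_mono (hφ.sub (integrable_const _)).norm hi.norm.integral_prod_left fun x => ?_
  have : φ x - ∫ y, φ y ∂π = ∫ y, (φ x - φ y) ∂π := by
    rw [integral_sub (integrable_const _) hφ]
    simp
  simp only [this]
  exact norm_integral_le_integral_norm _

/-- The triangle inequality through `m`; this undoes symmetrization in the lower bound. -/
lemma integral_norm_sub_le_two_mul {Ω V : Type*} [MeasurableSpace Ω] {π : Measure Ω}
    [IsProbabilityMeasure π] [NormedAddCommGroup V] {φ : Ω → V} (hφ : Integrable φ π) (m : V) :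
    ∫ p, ‖φ p.1 - φ p.2‖ ∂(π.prod π) ≤ 2 * ∫ x, ‖φ x - m‖ ∂π := by
  have hm : Integrable (fun x => ‖φ x - m‖) π := (hφ.sub (integrable_const _)).norm
  calc ∫ p, ‖φ p.1 - φ p.2‖ ∂(π.prod π)
      ≤ ∫ p : Ω × Ω, (‖φ p.1 - m‖ + ‖φ p.2 - m‖) ∂(π.prod π) := by
        refine integral_mono ((hφ.comp_fst π).sub (hφ.comp_snd π)).norm
          ((hm.comp_fst π).add (hm.comp_snd π)) fun p => ?_
        simpa using norm_sub_le (φ p.1 - m) (φ p.2 - m)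
    _ = 2 * ∫ x, ‖φ x - m‖ ∂π := by
        rw [integral_add (hm.comp_fst π) (hm.comp_snd π),
          integral_fun_fst (f := fun x => ‖φ x - m‖), integral_fun_snd (f := fun x => ‖φ x - m‖)]
        simp
        ring

variable {E : Type*} [NormedAddCommGroup E] [InnerProductSpace ℝ E] [FiniteDimensional ℝ E]
  [MeasurableSpace E] [BorelSpace E]

omit [FiniteDimensional ℝ E] [MeasurableSpace E] [BorelSpace E] in
lemma continuous_sum_rankOne {ι : Type*} [Fintype ι] :
    Continuous fun p : (ι → E) × (ι → E) => ∑ k, rankOne ℝ (p.1 k) (p.2 k) := by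
  refine continuous_finsetSum _ fun k _ => ?_
  exact ((rankOne ℝ (E := E) (F := E)).continuous.comp (by fun_prop)).clm_apply (by fun_prop)

lemma integrable_norm_sq_of_isGaussian (μ : Measure E) [IsGaussian μ] :
    Integrable (fun x => ‖x‖ ^ 2) μ :=
  (IsGaussian.memLp_two_id (μ := μ)).integrable_norm_pow two_ne_zero

lemma integrable_sum_rankOne_self {ι : Type*} [Fintype ι] (μ : Measure E) [IsGaussian μ] :
    Integrable (fun x : ι → E => ∑ k, rankOne ℝ (x k) (x k)) (Measure.pi fun _ : ι => μ) := by
  have h : Integrable (fun x : ι → E => ∑ k, ‖x k‖ ^ 2) (Measure.pi fun _ : ι => μ) :=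
    integrable_finsetSum _ fun k _ => integrable_comp_eval (μ := fun _ : ι => μ)
      (f := fun x => ‖x‖ ^ 2) (integrable_norm_sq_of_isGaussian μ)
  refine h.mono' ?_ (.of_forall fun x => ?_)
  · exact (continuous_sum_rankOne.comp (f := fun x : ι → E => (x, x))
      (by fun_prop)).aestronglyMeasurable
  · refine (norm_sum_le _ _).trans (Finset.sum_le_sum fun k _ => ?_)
    rw [InnerProductSpace.norm_rankOne, sq]

lemma integrable_norm_sum_rankOne_prod {ι : Type*} [Fintype ι] (μ : Measure E) [IsGaussian μ] :
    Integrable (fun p : (ι → E) × (ι → E) => ‖∑ k, rankOne ℝ (p.1 k) (p.2 k)‖)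
      ((Measure.pi fun _ : ι => μ).prod (Measure.pi fun _ : ι => μ)) := by
  have h : Integrable (fun p : (ι → E) × (ι → E) => ∑ k, ‖p.1 k‖ * ‖p.2 k‖)
      ((Measure.pi fun _ : ι => μ).prod (Measure.pi fun _ : ι => μ)) :=
    integrable_finsetSum _ fun k _ => (integrable_eval_pi μ k).norm.mul_prod
      (integrable_eval_pi μ k).norm
  refine (h.mono' continuous_sum_rankOne.aestronglyMeasurable (.of_forall fun p => ?_)).norm
  refine (norm_sum_le _ _).trans (Finset.sum_le_sum fun k _ => ?_)
  rw [InnerProductSpace.norm_rankOne]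

lemma integral_sum_rankOne_self {ι : Type*} [Fintype ι] {μ : Measure E} [IsGaussian μ]
    {Q : E →L[ℝ] E} (hQ : ∀ u v, ∫ x, ⟪u, x⟫ * ⟪v, x⟫ ∂μ = ⟪u, Q v⟫) :
    ∫ x : ι → E, ∑ k, rankOne ℝ (x k) (x k) ∂(Measure.pi fun _ : ι => μ) =
      (Fintype.card ι : ℝ) • Q := by
  have hi := integrable_sum_rankOne_self (ι := ι) μ
  ext1 v
  refine ext_inner_left ℝ fun u => ?_
  rw [ContinuousLinearMap.integral_apply hi, ← integral_inner (hi.apply_continuousLinearMap v)]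
  have e (x : ι → E) : ⟪u, (∑ k, rankOne ℝ (x k) (x k)) v⟫ = ∑ k, ⟪u, x k⟫ * ⟪v, x k⟫ := by
    simp only [sum_apply, rankOne_apply, inner_sum, real_inner_smul_right]
    exact Finset.sum_congr rfl fun k _ => by rw [real_inner_comm v, mul_comm]
  have hk : Integrable (fun x => ⟪u, x⟫ * ⟪v, x⟫) μ :=
    (memLp_inner_of_isGaussian μ u).integrable_mul (memLp_inner_of_isGaussian μ v)
  simp_rw [e]
  rw [integral_finsetSum _ fun k _ => integrable_comp_eval (μ := fun _ : ι => μ)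
    (f := fun x => ⟪u, x⟫ * ⟪v, x⟫) hk]
  have e2 (k : ι) : ∫ x : ι → E, ⟪u, x k⟫ * ⟪v, x k⟫ ∂(Measure.pi fun _ : ι => μ) = ⟪u, Q v⟫ :=
    (integral_comp_eval (μ := fun _ : ι => μ) (f := fun x => ⟪u, x⟫ * ⟪v, x⟫)
      (by fun_prop)).trans (hQ u v)
  simp_rw [e2]
  simp [real_inner_smul_right]

/-- Decoupling of the quadratic expression `∑ₖ xₖ xₖᵀ` by the rotation invariance of centered
Gaussian measures. -/
lemma integral_norm_sub_eq_integral_norm_add {ι : Type*} [Fintype ι] {μ : Measure E}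
    [IsGaussian μ] (hμ : ∫ x, x ∂μ = 0) :
    ∫ p : (ι → E) × (ι → E), ‖∑ k, rankOne ℝ (p.1 k) (p.1 k) - ∑ k, rankOne ℝ (p.2 k) (p.2 k)‖
        ∂((Measure.pi fun _ : ι => μ).prod (Measure.pi fun _ : ι => μ)) =
      ∫ p : (ι → E) × (ι → E), ‖∑ k, rankOne ℝ (p.1 k) (p.2 k) + ∑ k, rankOne ℝ (p.2 k) (p.1 k)‖
        ∂((Measure.pi fun _ : ι => μ).prod (Measure.pi fun _ : ι => μ)) := by
  set π := Measure.pi fun _ : ι => μ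
  have h0 : π[id] = 0 := by
    ext1 k
    simp only [id_eq]
    rw [eval_integral fun i => integrable_eval_pi μ i]
    exact (integral_comp_eval (μ := fun _ : ι => μ) (f := fun x => x) (by fun_prop)).trans hμ
  -- At angle `π/4` the pair becomes `((x + y)/√2, (y - x)/√2)`; in the difference of the two
  -- squares only the cross terms survive.
  have hrot := IsGaussian.map_rotation_eq_self h0 (Real.pi / 4)
  have hc : Continuous fun p : (ι → E) × (ι → E) =>
      ‖∑ k, rankOne ℝ (p.1 k) (p.1 k) - ∑ k, rankOne ℝ (p.2 k) (p.2 k)‖ :=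
    ((continuous_sum_rankOne.comp (f := fun p : (ι → E) × (ι → E) => (p.1, p.1))
      (by fun_prop)).sub (continuous_sum_rankOne.comp
      (f := fun p : (ι → E) × (ι → E) => (p.2, p.2)) (by fun_prop))).norm
  conv_lhs => rw [← hrot]
  rw [integral_map (by fun_prop) hc.aestronglyMeasurable]
  refine integral_congr_ae (.of_forall fun p => ?_)
  simp only [ContinuousLinearMap.rotation_apply, Real.cos_pi_div_four, Real.sin_pi_div_four]
  congr 1
  rw [← Finset.sum_sub_distrib, ← Finset.sum_add_distrib]
  refine Finset.sum_congr rfl fun k _ => ?_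
  have h2 : (√2 / 2) * (√2 / 2) = (1 / 2 : ℝ) := by
    rw [div_mul_div_comm, Real.mul_self_sqrt (by norm_num)]; norm_num
  ext1 v
  simp only [Pi.add_apply, Pi.smul_apply, sub_apply, add_apply, rankOne_apply, inner_add_left,
    real_inner_smul_left]
  match_scalars
  · linear_combination 2 * ⟪p.2 k, v⟫ * h2
  · linear_combination 2 * ⟪p.1 k, v⟫ * h2

end Symmetrization

/-! ### Diagonalizing the covariance -/

section CovarianceOperator

variable {E : Type*} [NormedAddCommGroup E] [InnerProductSpace ℝ E] [FiniteDimensional ℝ E]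
  [MeasurableSpace E] [BorelSpace E]

omit [BorelSpace E] in
/-- The covariance operator of a Gaussian measure is diagonal in some orthonormal basis, with
nonnegative eigenvalues. -/
lemma exists_orthonormalBasis_covariance {μ : Measure E} {Q : E →L[ℝ] E}
    (hQ : ∀ u v, ∫ x, ⟪u, x⟫ * ⟪v, x⟫ ∂μ = ⟪u, Q v⟫) :
    ∃ (b : OrthonormalBasis (Fin (Module.finrank ℝ E)) ℝ E)
      (lam : Fin (Module.finrank ℝ E) → ℝ), (∀ j, 0 ≤ lam j) ∧ ∀ j, Q (b j) = lam j • b j := by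
  have hsym : (Q : E →ₗ[ℝ] E).IsSymmetric := fun u v => by
    change ⟪Q u, v⟫ = ⟪u, Q v⟫
    rw [real_inner_comm, ← hQ, ← hQ]
    simp_rw [mul_comm]
  have hb (j) : Q (hsym.eigenvectorBasis rfl j) =
      hsym.eigenvalues rfl j • hsym.eigenvectorBasis rfl j := hsym.apply_eigenvectorBasis rfl j
  refine ⟨hsym.eigenvectorBasis rfl, hsym.eigenvalues rfl, fun j => ?_, hb⟩
  have h := hQ (hsym.eigenvectorBasis rfl j) (hsym.eigenvectorBasis rfl j)
  rw [hb, real_inner_smul_right, real_inner_self_eq_norm_sq, OrthonormalBasis.norm_eq_one] at h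
  have h0 : 0 ≤ ∫ x, ⟪hsym.eigenvectorBasis rfl j, x⟫ * ⟪hsym.eigenvectorBasis rfl j, x⟫ ∂μ :=
    integral_nonneg fun x => mul_self_nonneg _
  linarith

variable {κ : Type*} [Fintype κ] {b : OrthonormalBasis κ ℝ E} {lam : κ → ℝ} {μ : Measure E}
  {Q : E →L[ℝ] E}

omit [FiniteDimensional ℝ E] [MeasurableSpace E] [BorelSpace E] in
lemma inner_apply_of_diagonal (hb : ∀ j, Q (b j) = lam j • b j) (a : E) (i : κ) :
    ⟪b i, Q a⟫ = lam i * ⟪b i, a⟫ := by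
  classical
  conv_lhs => rw [← b.sum_repr' a]
  simp only [map_sum, map_smul, hb, inner_sum, real_inner_smul_right,
    orthonormal_iff_ite.1 b.orthonormal]
  simp [mul_comm]

omit [FiniteDimensional ℝ E] [BorelSpace E] in
lemma integral_inner_sq_of_diagonal (hQ : ∀ u v, ∫ x, ⟪u, x⟫ * ⟪v, x⟫ ∂μ = ⟪u, Q v⟫)
    (hb : ∀ j, Q (b j) = lam j • b j) (a : E) :
    ∫ x, ⟪a, x⟫ ^ 2 ∂μ = ∑ j, lam j * ⟪b j, a⟫ ^ 2 := by
  simp_rw [sq, hQ]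
  rw [← b.sum_inner_mul_inner]
  refine Finset.sum_congr rfl fun j _ => ?_
  rw [inner_apply_of_diagonal hb, real_inner_comm]
  ring

omit [FiniteDimensional ℝ E] in
lemma integral_norm_sq_of_diagonal [IsGaussian μ]
    (hQ : ∀ u v, ∫ x, ⟪u, x⟫ * ⟪v, x⟫ ∂μ = ⟪u, Q v⟫)
    (hb : ∀ j, Q (b j) = lam j • b j) : ∫ x, ‖x‖ ^ 2 ∂μ = ∑ j, lam j := by
  simp_rw [← b.sum_sq_inner_right]
  rw [integral_finsetSum _ fun j _ => integrable_inner_sq_of_isGaussian μ (b j)]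
  refine Finset.sum_congr rfl fun j _ => ?_
  simp_rw [sq, hQ, hb, real_inner_smul_right, real_inner_self_eq_norm_sq]
  simp

omit [FiniteDimensional ℝ E] [MeasurableSpace E] [BorelSpace E] in
lemma exists_norm_le_of_diagonal [Nonempty κ] (h0 : ∀ j, 0 ≤ lam j)
    (hb : ∀ j, Q (b j) = lam j • b j) : ∃ j, ‖Q‖ ≤ lam j := by
  obtain ⟨j, hj⟩ := Finite.exists_max lam
  refine ⟨j, Q.opNorm_le_bound (h0 j) fun v => ?_⟩
  refine le_of_sq_le_sq ?_ (mul_nonneg (h0 j) (norm_nonneg _))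
  rw [mul_pow, ← b.sum_sq_inner_right, ← b.sum_sq_inner_right v, Finset.mul_sum]
  refine Finset.sum_le_sum fun i _ => ?_
  rw [inner_apply_of_diagonal hb, mul_pow]
  have := h0 i
  gcongr
  exact hj i

end CovarianceOperator

/-! ### Upper bound -/

section UpperBound

/-- Jensen for the square root, read off from the nonnegative variance of `√f`. -/
lemma integral_sqrt_le {Ω : Type*} [MeasurableSpace Ω] {π : Measure Ω} [IsProbabilityMeasure π]
    {f : Ω → ℝ} (hf : Integrable f π) (h0 : ∀ x, 0 ≤ f x) :
    Integrable (fun x => √(f x)) π ∧ ∫ x, √(f x) ∂π ≤ √(∫ x, f x ∂π) := by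
  have hm : AEStronglyMeasurable (fun x => √(f x)) π :=
    Real.continuous_sqrt.comp_aestronglyMeasurable hf.1
  have h2 : MemLp (fun x => √(f x)) 2 π := by
    rw [memLp_two_iff_integrable_sq hm]
    simpa only [Real.sq_sqrt (h0 _)] using hf
  refine ⟨h2.integrable (by norm_num), Real.le_sqrt_of_sq_le ?_⟩
  have h := variance_nonneg (fun x => √(f x)) π
  rw [variance_eq_sub h2] at h
  simp only [Pi.pow_apply, Real.sq_sqrt (h0 _)] at h
  linarith

variable {E : Type*} [NormedAddCommGroup E] [InnerProductSpace ℝ E] [FiniteDimensional ℝ E]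
  [MeasurableSpace E] [BorelSpace E]

-- The left side is `‖N* a‖²` for the operator `N` with columns `yₖ`. Thus the factor `L` in
-- Chevet's inequality becomes the norm of a Gaussian matrix, to which Chevet applies again.
omit [FiniteDimensional ℝ E] [MeasurableSpace E] [BorelSpace E] in
lemma sum_inner_sq_le {ι : Type*} [Fintype ι] (y : ι → E) (a : E) :
    ∑ k, ⟪y k, a⟫ ^ 2 ≤
      ‖∑ k, rankOne ℝ (y k) (EuclideanSpace.basisFun ι ℝ k)‖ ^ 2 * ‖a‖ ^ 2 := by
  set N : EuclideanSpace ℝ ι →L[ℝ] E := ∑ k, rankOne ℝ (y k) (EuclideanSpace.basisFun ι ℝ k)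
    with hN
  let z : EuclideanSpace ℝ ι := WithLp.toLp 2 fun k => ⟪y k, a⟫
  have hz : ‖z‖ ^ 2 = ∑ k, ⟪y k, a⟫ ^ 2 := by rw [EuclideanSpace.real_norm_sq_eq]
  have h1 : ⟪N z, a⟫ = ‖z‖ ^ 2 := by
    rw [hz, hN]
    simp only [sum_apply, rankOne_apply, sum_inner, real_inner_smul_left]
    refine Finset.sum_congr rfl fun k _ => ?_
    rw [EuclideanSpace.basisFun_inner, sq]
  have h2 : ‖z‖ ^ 2 ≤ ‖N‖ * ‖z‖ * ‖a‖ := by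
    rw [← h1]
    exact (real_inner_le_norm _ _).trans (by gcongr; exact N.le_opNorm z)
  rw [← hz, ← mul_pow]
  refine pow_le_pow_left₀ (norm_nonneg _) ?_ 2
  rcases (norm_nonneg z).eq_or_lt with h | h
  · rw [← h]; positivity
  · refine le_of_mul_le_mul_left ?_ h
    linarith

/-- The upper bound of Koltchinskii and Lounici for sums of independent centered Gaussian
vectors. -/
theorem integral_norm_sum_rankOne_sub_le {ι : Type*} [Fintype ι] {μ : Measure E} [IsGaussian μ]
    (hμ : ∫ x, x ∂μ = 0) {Q : E →L[ℝ] E} (hQ : ∀ u v, ∫ x, ⟪u, x⟫ * ⟪v, x⟫ ∂μ = ⟪u, Q v⟫) :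
    ∫ x : ι → E, ‖∑ k, rankOne ℝ (x k) (x k) - (Fintype.card ι : ℝ) • Q‖
        ∂(Measure.pi fun _ : ι => μ) ≤
      12 * (√‖Q‖ * √(Fintype.card ι * ∫ x, ‖x‖ ^ 2 ∂μ)) + 8 * ∫ x, ‖x‖ ^ 2 ∂μ := by
  obtain ⟨b, lam, hlam, hb⟩ := exists_orthonormalBasis_covariance hQ
  set n : ℝ := (Fintype.card ι : ℝ) with hn
  set t := ∫ x, ‖x‖ ^ 2 ∂μ with ht
  set s := ‖Q‖
  set π := Measure.pi fun _ : ι => μ with hπ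
  have ht0 : 0 ≤ t := integral_nonneg fun x => by positivity
  let w := fun j => √(lam j) • b j
  have hw (a : E) : ∫ x, ⟪a, x⟫ ^ 2 ∂μ = ∑ j, ⟪w j, a⟫ ^ 2 := by
    rw [integral_inner_sq_of_diagonal hQ hb]
    simp only [w, real_inner_smul_left, mul_pow, Real.sq_sqrt (hlam _)]
  have hwt : ∑ j, ‖w j‖ ^ 2 = t := by
    rw [ht, integral_norm_sq_of_diagonal hQ hb]
    simp only [w, norm_smul, OrthonormalBasis.norm_eq_one, Real.norm_eq_abs, sq_abs,
      Real.sq_sqrt (hlam _), mul_one]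
  have hws (a : E) : ∑ j, ⟪w j, a⟫ ^ 2 ≤ s * ‖a‖ ^ 2 := by
    rw [← hw]
    simp_rw [sq, hQ]
    calc ⟪a, Q a⟫ ≤ ‖a‖ * ‖Q a‖ := real_inner_le_norm _ _
      _ ≤ ‖a‖ * (s * ‖a‖) := by gcongr; exact Q.le_opNorm a
      _ = _ := by ring
  let e := EuclideanSpace.basisFun ι ℝ
  let N : (ι → E) → ℝ := fun y => ‖∑ k, rankOne ℝ (y k) (e k)‖
  have hNi : Integrable N π := integrable_norm_sum_rankOne μ _
  -- Chevet with the orthonormal basis as fixed vectors: `L = 1` and `T = n`.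
  have hN : ∫ y, N y ∂π ≤ 2 * (√t + √s * √n) := by
    have := integral_norm_sum_rankOne_le hμ hw (fun k => e k) (norm_nonneg Q) zero_le_one hws
      (fun a => by rw [e.sum_sq_inner_right]; simp)
    simpa [hwt, hn] using this
  have hsq : Integrable (fun y : ι → E => ∑ k, ‖y k‖ ^ 2) π :=
    integrable_finsetSum _ fun k _ => integrable_comp_eval (μ := fun _ : ι => μ)
      (f := fun x => ‖x‖ ^ 2) (integrable_norm_sq_of_isGaussian μ)
  have hsqt : ∫ y : ι → E, ∑ k, ‖y k‖ ^ 2 ∂π = n * t := by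
    rw [integral_finsetSum _ fun k _ => integrable_comp_eval (μ := fun _ : ι => μ)
      (f := fun x => ‖x‖ ^ 2) (integrable_norm_sq_of_isGaussian μ)]
    have (k : ι) : ∫ y : ι → E, ‖y k‖ ^ 2 ∂π = t :=
      integral_comp_eval (μ := fun _ : ι => μ) (f := fun x => ‖x‖ ^ 2) (by fun_prop)
    exact (Finset.sum_congr rfl fun k _ => this k).trans (by simp [hn])
  obtain ⟨hri, hr⟩ := integral_sqrt_le hsq fun y => by positivity
  rw [hsqt] at hr
  have hX := integrable_norm_sum_rankOne_prod (ι := ι) μ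
  have hcross : ∫ p : (ι → E) × (ι → E), ‖∑ k, rankOne ℝ (p.1 k) (p.2 k)‖ ∂(π.prod π) ≤
      2 * (√t * (2 * (√t + √s * √n)) + √s * √(n * t)) := by
    rw [integral_prod_symm _ hX]
    calc ∫ y, ∫ x, ‖∑ k, rankOne ℝ (x k) (y k)‖ ∂π ∂π
        ≤ ∫ y, 2 * (√t * N y + √s * √(∑ k, ‖y k‖ ^ 2)) ∂π := by
          refine integral_mono hX.integral_prod_right
            (((hNi.const_mul _).add (hri.const_mul _)).const_mul _) fun y => ?_
          have := integral_norm_sum_rankOne_le hμ hw y (norm_nonneg Q) (norm_nonneg _) hws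
            (sum_inner_sq_le y)
          simpa only [hwt] using this
      _ = 2 * (√t * ∫ y, N y ∂π + √s * ∫ y, √(∑ k, ‖y k‖ ^ 2) ∂π) := by
          rw [integral_const_mul, integral_add (hNi.const_mul _) (hri.const_mul _),
            integral_const_mul, integral_const_mul]
      _ ≤ _ := by gcongr
  have hswap : ∫ p : (ι → E) × (ι → E), ‖∑ k, rankOne ℝ (p.2 k) (p.1 k)‖ ∂(π.prod π) =
      ∫ p : (ι → E) × (ι → E), ‖∑ k, rankOne ℝ (p.1 k) (p.2 k)‖ ∂(π.prod π) :=
    integral_prod_swap (fun p : (ι → E) × (ι → E) => ‖∑ k, rankOne ℝ (p.1 k) (p.2 k)‖)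
  have hmain := integral_norm_sub_integral_le (integrable_sum_rankOne_self (ι := ι) μ)
  rw [integral_sum_rankOne_self hQ, integral_norm_sub_eq_integral_norm_add hμ] at hmain
  have hadd : ∫ p : (ι → E) × (ι → E),
      ‖∑ k, rankOne ℝ (p.1 k) (p.2 k) + ∑ k, rankOne ℝ (p.2 k) (p.1 k)‖ ∂(π.prod π) ≤
      2 * ∫ p : (ι → E) × (ι → E), ‖∑ k, rankOne ℝ (p.1 k) (p.2 k)‖ ∂(π.prod π) := by
    have hX' : Integrable (fun p : (ι → E) × (ι → E) => ‖∑ k, rankOne ℝ (p.2 k) (p.1 k)‖)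
      (π.prod π) := hX.swap
    rw [two_mul]
    nth_rw 2 [← hswap]
    rw [← integral_add hX hX']
    refine integral_mono_of_nonneg (.of_forall fun p => norm_nonneg _) (hX.add hX')
      (.of_forall fun p => norm_add_le _ _)
  refine hmain.trans (hadd.trans ?_)
  have e1 : √(n * t) = √n * √t := Real.sqrt_mul (by positivity) _
  have e2 : √t * √t = t := Real.mul_self_sqrt ht0
  -- The cross term is at most `4 t + 6 √s √(n t)`; its two copies give the constants 8 and 12.
  rw [e1] at hcross ⊢
  nlinarith [hcross, e2]

end UpperBound

/-! ### Lower bound -/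

section LowerBound

/-- Integrate `1 - cos u ≤ |u|` at `u = x / √v`: the characteristic function gives `E cos u = exp
(-1/2) ≤ 2/3`, leaving `1/3`. -/
lemma sqrt_div_three_le_integral_abs_gaussianReal (v : NNReal) :
    √v / 3 ≤ ∫ x, |x| ∂(gaussianReal 0 v) := by
  rcases eq_or_ne v 0 with rfl | hv
  · simp
  have hv0 : (0 : ℝ) < v := by positivity
  have hs : 0 < √(v : ℝ) := Real.sqrt_pos.2 hv0
  set a := (√(v : ℝ))⁻¹ with ha
  have hcos : ∫ x, Real.cos (a * x) ∂(gaussianReal 0 v) = Real.exp (-(1 / 2)) := by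
    have h := congrArg Complex.re (charFun_gaussianReal (μ := 0) (v := v) a)
    rw [charFun_apply_real] at h
    have hi : Integrable (fun x : ℝ => Complex.exp (a * x * Complex.I)) (gaussianReal 0 v) := by
      refine (integrable_const (1 : ℝ)).mono' (by fun_prop) (.of_forall fun x => ?_)
      rw [← Complex.ofReal_mul, Complex.norm_exp_ofReal_mul_I]
    have h1 : (∫ x : ℝ, Complex.exp (a * x * Complex.I) ∂(gaussianReal 0 v)).re =
        ∫ x : ℝ, (Complex.exp (a * x * Complex.I)).re ∂(gaussianReal 0 v) :=
      (integral_re hi).symm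
    rw [h1] at h
    have h4 (x : ℝ) : (Complex.exp (a * x * Complex.I)).re = Real.cos (a * x) := by
      rw [← Complex.ofReal_mul, Complex.exp_ofReal_mul_I_re]
    simp_rw [h4] at h
    rw [h]
    have h2 : (v : ℝ) * a ^ 2 = 1 := by
      rw [ha, inv_pow, Real.sq_sqrt hv0.le, mul_inv_cancel₀ hv0.ne']
    have h3 : (a : ℂ) * ((0 : ℝ) : ℂ) * Complex.I - (v : ℂ) * (a : ℂ) ^ 2 / 2 =
        ((-(1 / 2) : ℝ) : ℂ) := by
      have : ((v : ℝ) : ℂ) * (a : ℂ) ^ 2 = 1 := by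
        rw [← Complex.ofReal_pow, ← Complex.ofReal_mul, h2]; simp
      rw [show (v : ℂ) = ((v : ℝ) : ℂ) from rfl, this]
      simp
    rw [h3, Complex.exp_ofReal_re]
  have hci : Integrable (fun x : ℝ => Real.cos (a * x)) (gaussianReal 0 v) :=
    (integrable_const (1 : ℝ)).mono' (by fun_prop)
      (.of_forall fun x => by simpa using Real.abs_cos_le_one (a * x))
  have hi : Integrable (fun x : ℝ => |x|) (gaussianReal 0 v) :=
    (IsGaussian.integrable_id (μ := gaussianReal 0 v)).abs
  have hle : ∫ x, (1 - Real.cos (a * x)) ∂(gaussianReal 0 v) ≤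
      ∫ x, a * |x| ∂(gaussianReal 0 v) := by
    refine integral_mono ((integrable_const _).sub hci) (hi.const_mul a) fun x => ?_
    have h1 : 1 - Real.cos (a * x) = 2 * Real.sin (a * x / 2) ^ 2 := by
      rw [Real.sin_sq_eq_half_sub, mul_div_cancel₀ _ two_ne_zero]
      ring
    have h2 : |Real.sin (a * x / 2)| ≤ |a * x / 2| := Real.abs_sin_le_abs
    have h3 : |Real.sin (a * x / 2)| ≤ 1 := Real.abs_sin_le_one _
    have h4 : |a * x / 2| = a * |x| / 2 := by
      rw [abs_div, abs_mul, abs_of_pos (inv_pos.2 hs), abs_two]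
    simp only
    rw [h1, ← sq_abs]
    nlinarith [abs_nonneg (Real.sin (a * x / 2))]
  rw [integral_sub (integrable_const _) hci, hcos, integral_const_mul] at hle
  have he : Real.exp (-(1 / 2)) ≤ 2 / 3 := by
    rw [Real.exp_neg]
    have := Real.add_one_le_exp (1 / 2 : ℝ)
    exact (inv_le_comm₀ (Real.exp_pos _) (by norm_num)).2 (by linarith)
  have h : 1 / 3 ≤ a * ∫ x, |x| ∂(gaussianReal 0 v) := by
    simp only [integral_const, probReal_univ, smul_eq_mul, one_mul] at hle
    linarith
  rw [ha, inv_mul_eq_div, le_div_iff₀ hs] at h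
  linarith

variable {E : Type*} [NormedAddCommGroup E] [InnerProductSpace ℝ E] [FiniteDimensional ℝ E]
  [MeasurableSpace E] [BorelSpace E]

lemma sqrt_div_three_le_integral_abs_sum_inner {ι : Type*} [Fintype ι] {μ : Measure E}
    [IsGaussian μ] (hμ : ∫ x, x ∂μ = 0) (c : ι → E) :
    √(∑ k, ∫ x, ⟪c k, x⟫ ^ 2 ∂μ) / 3 ≤
      ∫ x, |∑ k, ⟪c k, x k⟫| ∂(Measure.pi fun _ : ι => μ) := by
  have h0 : 0 ≤ ∑ k, ∫ x, ⟪c k, x⟫ ^ 2 ∂μ :=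
    Finset.sum_nonneg fun k _ => integral_nonneg fun x => sq_nonneg _
  have h := sqrt_div_three_le_integral_abs_gaussianReal (∑ k, ∫ x, ⟪c k, x⟫ ^ 2 ∂μ).toNNReal
  rw [Real.coe_toNNReal _ h0, ← map_sum_inner_pi hμ,
    integral_map (Continuous.aemeasurable (by fun_prop)) (by fun_prop)] at h
  exact h

/-- The fluctuation part of the lower bound of Koltchinskii and Lounici. -/
theorem le_integral_norm_sum_rankOne_sub {ι : Type*} [Fintype ι] {μ : Measure E} [IsGaussian μ]
    (hμ : ∫ x, x ∂μ = 0) {Q : E →L[ℝ] E} (hQ : ∀ u v, ∫ x, ⟪u, x⟫ * ⟪v, x⟫ ∂μ = ⟪u, Q v⟫) :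
    √‖Q‖ * √(Fintype.card ι * ∫ x, ‖x‖ ^ 2 ∂μ) ≤
      18 * ∫ x : ι → E, ‖∑ k, rankOne ℝ (x k) (x k) - (Fintype.card ι : ℝ) • Q‖
        ∂(Measure.pi fun _ : ι => μ) := by
  obtain ⟨b, lam, hlam, hb⟩ := exists_orthonormalBasis_covariance hQ
  have htr := integral_norm_sq_of_diagonal hQ hb
  have hcov := integral_inner_sq_of_diagonal hQ hb
  set n : ℝ := (Fintype.card ι : ℝ) with hn
  set t := ∫ x, ‖x‖ ^ 2 ∂μ with ht
  set π := Measure.pi fun _ : ι => μ with hπ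
  have hI0 : 0 ≤ ∫ x : ι → E, ‖∑ k, rankOne ℝ (x k) (x k) - n • Q‖ ∂π :=
    integral_nonneg fun x => norm_nonneg _
  have ht0' : 0 ≤ t := integral_nonneg fun x => by positivity
  have hn0' : 0 ≤ n := Nat.cast_nonneg _
  rcases ht0'.eq_or_lt with h0 | ht0
  · rw [← h0]
    simpa using hI0
  rcases hn0'.eq_or_lt with h0 | hn0
  · rw [← h0] at hI0 ⊢
    simpa using hI0
  have : Nonempty (Fin (Module.finrank ℝ E)) := by
    by_contra hne
    rw [not_nonempty_iff] at hne
    simp only [Finset.univ_eq_empty, Finset.sum_empty] at htr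
    exact ht0.ne' htr
  obtain ⟨i, hi⟩ := exists_norm_le_of_diagonal hlam hb
  have hsingle (a : E) (j) : lam j * ⟪b j, a⟫ ^ 2 ≤ ∫ x, ⟪a, x⟫ ^ 2 ∂μ := by
    rw [hcov]
    exact Finset.single_le_sum (f := fun j => lam j * ⟪b j, a⟫ ^ 2)
      (fun j _ => mul_nonneg (hlam j) (sq_nonneg _)) (Finset.mem_univ j)
  have hX := integrable_norm_sum_rankOne_prod (ι := ι) μ
  let M : (ι → E) × (ι → E) → E →L[ℝ] E := fun p =>
    ∑ k, rankOne ℝ (p.1 k) (p.2 k) + ∑ k, rankOne ℝ (p.2 k) (p.1 k)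
  have hMc : Continuous M := continuous_sum_rankOne.add
    (continuous_sum_rankOne.comp (f := fun p : (ι → E) × (ι → E) => (p.2, p.1)) (by fun_prop))
  have hMi : Integrable (fun p => ‖M p‖) (π.prod π) :=
    (hX.add hX.swap).mono' hMc.norm.aestronglyMeasurable
      (.of_forall fun p => by rw [norm_norm]; exact norm_add_le _ _)
  let A : Fin (Module.finrank ℝ E) → (ι → E) × (ι → E) → ℝ := fun j p => ⟪b j, M p (b i)⟫
  have hAM (j) (p) : |A j p| ≤ ‖M p‖ := by
    refine (abs_real_inner_le_norm _ _).trans ?_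
    have := (M p).le_opNorm (b i)
    simpa [b.norm_eq_one] using this
  have hAi (j) : Integrable (fun p => |A j p|) (π.prod π) := by
    refine hMi.mono' ?_ (.of_forall fun p => by rw [Real.norm_eq_abs, abs_abs]; exact hAM j p)
    have : Continuous fun p => |A j p| := by
      simp only [A]
      exact (continuous_const.inner (hMc.clm_apply continuous_const)).abs
    exact this.aestronglyMeasurable
  have hA (j) (x y : ι → E) : A j (x, y) = ∑ k, ⟪⟪y k, b i⟫ • b j + ⟪b j, y k⟫ • b i, x k⟫ := by
    simp only [A, M, add_apply, sum_apply, rankOne_apply, inner_add_right, inner_sum,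
      real_inner_smul_right, inner_add_left, real_inner_smul_left, ← Finset.sum_add_distrib]
    refine Finset.sum_congr rfl fun k _ => ?_
    rw [real_inner_comm (b i) (x k)]
    ring
  -- For `j ≠ i` the second term is orthogonal to `b j`; for `j = i` the two terms coincide and
  -- reinforce each other.
  have hcoef (j) (y : E) : ⟪y, b i⟫ ^ 2 ≤ ⟪b j, ⟪y, b i⟫ • b j + ⟪b j, y⟫ • b i⟫ ^ 2 := by
    rw [inner_add_right, real_inner_smul_right, real_inner_smul_right,
      real_inner_self_eq_norm_sq, b.norm_eq_one]
    by_cases hij : j = i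
    · subst hij
      rw [real_inner_self_eq_norm_sq, b.norm_eq_one, real_inner_comm]
      nlinarith [sq_nonneg ⟪b j, y⟫]
    · rw [b.inner_eq_zero hij]
      simp
  -- Cauchy–Schwarz replaces the Euclidean norm of `(⟪b i, y k⟫)ₖ` by its `ℓ¹` norm over `√n`, so
  -- that first absolute moments suffice when integrating in `y`.
  have hAx (j) (y : ι → E) :
      √(lam j) / (3 * √n) * ∑ k, |⟪b i, y k⟫| ≤ ∫ x, |A j (x, y)| ∂π := by
    simp_rw [hA]
    refine le_trans ?_ (sqrt_div_three_le_integral_abs_sum_inner hμ _)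
    have h1 : lam j * ∑ k, ⟪b i, y k⟫ ^ 2 ≤
        ∑ k, ∫ x, ⟪⟪y k, b i⟫ • b j + ⟪b j, y k⟫ • b i, x⟫ ^ 2 ∂μ := by
      rw [Finset.mul_sum]
      refine Finset.sum_le_sum fun k _ => le_trans ?_ (hsingle _ j)
      rw [real_inner_comm]
      exact mul_le_mul_of_nonneg_left (hcoef j (y k)) (hlam j)
    have h2 : ∑ k, |⟪b i, y k⟫| ≤ √n * √(∑ k, ⟪b i, y k⟫ ^ 2) := by
      rw [← Real.sqrt_mul hn0.le]
      refine Real.le_sqrt_of_sq_le ?_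
      have := sq_sum_le_card_mul_sum_sq (s := Finset.univ) (f := fun k => |⟪b i, y k⟫|)
      simpa only [sq_abs, Finset.card_univ] using this
    have h3 := Real.sqrt_le_sqrt h1
    rw [Real.sqrt_mul (hlam j)] at h3
    have hsn : 0 < √n := Real.sqrt_pos.2 hn0
    calc √(lam j) / (3 * √n) * ∑ k, |⟪b i, y k⟫|
        ≤ √(lam j) / (3 * √n) * (√n * √(∑ k, ⟪b i, y k⟫ ^ 2)) := by gcongr
      _ = √(lam j) * √(∑ k, ⟪b i, y k⟫ ^ 2) / 3 := by field_simp
      _ ≤ _ := by gcongr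
  have habs (k : ι) : √(lam i) / 3 ≤ ∫ y : ι → E, |⟪b i, y k⟫| ∂π := by
    classical
    have h := sqrt_div_three_le_integral_abs_sum_inner hμ (Pi.single k (b i) : ι → E)
    have e1 (y : ι → E) : ∑ l, ⟪(Pi.single k (b i) : ι → E) l, y l⟫ = ⟪b i, y k⟫ := by
      rw [Finset.sum_eq_single k (fun l _ hl => by simp [hl]) (by simp)]
      simp
    simp_rw [e1] at h
    refine le_trans ?_ h
    gcongr
    have e2 : lam i ≤ ∫ x, ⟪(Pi.single k (b i) : ι → E) k, x⟫ ^ 2 ∂μ := by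
      have := hsingle (b i) i
      rw [real_inner_self_eq_norm_sq, b.norm_eq_one] at this
      simpa using this
    exact e2.trans (Finset.single_le_sum
      (f := fun l => ∫ x, ⟪(Pi.single k (b i) : ι → E) l, x⟫ ^ 2 ∂μ)
      (fun l _ => integral_nonneg fun x => sq_nonneg _) (Finset.mem_univ k))
  have hyi (k : ι) : Integrable (fun y : ι → E => |⟪b i, y k⟫|) π :=
    integrable_comp_eval (μ := fun _ : ι => μ) (f := fun x => |⟪b i, x⟫|)
      (integrable_inner_of_isGaussian μ (b i)).abs
  have hAint (j) : √(lam j) * √(lam i) * √n / 9 ≤ ∫ p, |A j p| ∂(π.prod π) := by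
    rw [integral_prod_symm _ (hAi j)]
    have hsn : 0 < √n := Real.sqrt_pos.2 hn0
    calc √(lam j) * √(lam i) * √n / 9 = √(lam j) / (3 * √n) * (n * (√(lam i) / 3)) := by
          have hnn : √n * √n = n := Real.mul_self_sqrt hn0.le
          field_simp
          linear_combination 9 * √(lam j) * √(lam i) * hnn
      _ ≤ √(lam j) / (3 * √n) * ∑ k, ∫ y : ι → E, |⟪b i, y k⟫| ∂π := by
          gcongr
          refine le_trans (le_of_eq ?_) (Finset.sum_le_sum fun k _ => habs k)
          simp [hn]
      _ = ∫ y : ι → E, √(lam j) / (3 * √n) * ∑ k, |⟪b i, y k⟫| ∂π := by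
          rw [integral_const_mul, integral_finsetSum _ fun k _ => hyi k]
      _ ≤ _ := integral_mono ((integrable_finsetSum _ fun k _ => hyi k).const_mul _)
          (hAi j).integral_prod_right (hAx j)
  -- The weights `√(lam j)` have squared sum `t`, and the `A j p` are the coordinates of `M p (b
  -- i)`.
  have hCS (p) : ∑ j, √(lam j) * |A j p| ≤ √t * ‖M p‖ := by
    have h1 := Finset.sum_mul_sq_le_sq_mul_sq Finset.univ (fun j => √(lam j)) fun j => |A j p|
    simp only [Real.sq_sqrt (hlam _), sq_abs, A] at h1
    rw [b.sum_sq_inner_right, ← htr] at h1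
    have h2 : ‖M p (b i)‖ ≤ ‖M p‖ := by
      have := (M p).le_opNorm (b i)
      simpa [b.norm_eq_one] using this
    refine le_of_sq_le_sq (h1.trans ?_) (by positivity)
    rw [mul_pow, Real.sq_sqrt ht0.le]
    gcongr
  have hfin : t * (√(lam i) * √n / 9) ≤ √t * ∫ p, ‖M p‖ ∂(π.prod π) := by
    calc t * (√(lam i) * √n / 9) = ∑ j, √(lam j) * (√(lam j) * √(lam i) * √n / 9) := by
          rw [htr, Finset.sum_mul]
          refine Finset.sum_congr rfl fun j _ => ?_
          nth_rw 1 [← Real.mul_self_sqrt (hlam j)]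
          ring
      _ ≤ ∑ j, √(lam j) * ∫ p, |A j p| ∂(π.prod π) := by
          gcongr with j
          exact hAint j
      _ = ∫ p, ∑ j, √(lam j) * |A j p| ∂(π.prod π) := by
          rw [integral_finsetSum _ fun j _ => (hAi j).const_mul _]
          simp_rw [integral_const_mul]
      _ ≤ ∫ p, √t * ‖M p‖ ∂(π.prod π) :=
          integral_mono (integrable_finsetSum _ fun j _ => (hAi j).const_mul _)
            (hMi.const_mul _) hCS
      _ = _ := integral_const_mul _ _
  have hst : 0 < √t := Real.sqrt_pos.2 ht0
  have hfin2 : √t * (√(lam i) * √n / 9) ≤ ∫ p, ‖M p‖ ∂(π.prod π) := by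
    refine le_of_mul_le_mul_left (le_trans (le_of_eq ?_) hfin) hst
    rw [← mul_assoc, Real.mul_self_sqrt ht0.le]
  have hsym := integral_norm_sub_le_two_mul (integrable_sum_rankOne_self (ι := ι) μ) (n • Q)
  rw [integral_norm_sub_eq_integral_norm_add hμ] at hsym
  have hQi : √‖Q‖ ≤ √(lam i) := Real.sqrt_le_sqrt hi
  rw [Real.sqrt_mul hn0.le]
  have h4 : √‖Q‖ * (√n * √t) ≤ √(lam i) * (√n * √t) := by gcongr
  have h5 := hfin2.trans hsym
  linarith

/-- The lower bound on the deviation given by a single summand. -/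
theorem integral_norm_sq_sub_le {ι : Type*} [Fintype ι] [Nonempty ι] {μ : Measure E}
    [IsGaussian μ] (Q : E →L[ℝ] E) :
    ∫ x, ‖x‖ ^ 2 ∂μ - Fintype.card ι * ‖Q‖ ≤
      ∫ x : ι → E, ‖∑ k, rankOne ℝ (x k) (x k) - (Fintype.card ι : ℝ) • Q‖
        ∂(Measure.pi fun _ : ι => μ) := by
  obtain ⟨k₀⟩ := ‹Nonempty ι›
  have hsq : Integrable (fun x : ι → E => ‖x k₀‖ ^ 2) (Measure.pi fun _ : ι => μ) :=
    integrable_comp_eval (μ := fun _ : ι => μ) (f := fun x => ‖x‖ ^ 2)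
      (integrable_norm_sq_of_isGaussian μ)
  have e : ∫ x : ι → E, ‖x k₀‖ ^ 2 ∂(Measure.pi fun _ : ι => μ) = ∫ x, ‖x‖ ^ 2 ∂μ :=
    integral_comp_eval (μ := fun _ : ι => μ) (f := fun x => ‖x‖ ^ 2) (by fun_prop)
  have h : ∫ x : ι → E, (‖x k₀‖ ^ 2 - Fintype.card ι * ‖Q‖) ∂(Measure.pi fun _ : ι => μ) =
      ∫ x, ‖x‖ ^ 2 ∂μ - Fintype.card ι * ‖Q‖ := by
    rw [integral_sub hsq (integrable_const _), e]
    simp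
  rw [← h]
  refine integral_mono (hsq.sub (integrable_const _))
    ((integrable_sum_rankOne_self μ).sub (integrable_const _)).norm fun x => ?_
  -- Testing on `x k₀` itself: all terms of the quadratic form are nonnegative, and the `k₀` term is
  -- `‖x k₀‖ ^ 4`.
  have h1 : ‖x k₀‖ ^ 2 ≤ ‖∑ k, rankOne ℝ (x k) (x k)‖ := by
    set T := ∑ k, rankOne ℝ (x k) (x k) with hT
    rcases (norm_nonneg (x k₀)).eq_or_lt with h0 | h0
    · rw [← h0]; simp
    have h2 : ⟪x k₀, T (x k₀)⟫ = ∑ k, ⟪x k, x k₀⟫ ^ 2 := by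
      simp only [hT, sum_apply, rankOne_apply, inner_sum, real_inner_smul_right]
      exact Finset.sum_congr rfl fun k _ => by rw [real_inner_comm (x k), sq]
    have h3 : (‖x k₀‖ ^ 2) ^ 2 ≤ ∑ k, ⟪x k, x k₀⟫ ^ 2 := by
      rw [← real_inner_self_eq_norm_sq]
      exact Finset.single_le_sum (f := fun k => ⟪x k, x k₀⟫ ^ 2) (fun k _ => sq_nonneg _)
        (Finset.mem_univ k₀)
    have h4 : ⟪x k₀, T (x k₀)⟫ ≤ ‖x k₀‖ * (‖T‖ * ‖x k₀‖) :=
      (real_inner_le_norm _ _).trans (by gcongr; exact T.le_opNorm _)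
    have h5 : 0 < ‖x k₀‖ ^ 2 := by positivity
    refine le_of_mul_le_mul_left ?_ h5
    linarith
  have h6 := norm_sub_norm_le (∑ k, rankOne ℝ (x k) (x k)) ((Fintype.card ι : ℝ) • Q)
  rw [norm_smul, Real.norm_natCast] at h6
  simp only
  linarith

end LowerBound

/-! ### From matrices to operators -/

section SampleCovariance

variable {d : ℕ}

lemma toEuclideanCLM_vecMulVec (x : EuclideanSpace ℝ (Fin d)) :
    Matrix.toEuclideanCLM (𝕜 := ℝ) (Matrix.vecMulVec x.ofLp x.ofLp) = rankOne ℝ x x := by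
  ext v i
  simp [Matrix.vecMulVec_mulVec, PiLp.inner_apply, dotProduct, mul_comm]

lemma norm_sampleCovariance_sub {n : ℕ} (hn : n ≠ 0) (x : Fin n → EuclideanSpace ℝ (Fin d))
    (S : Matrix (Fin d) (Fin d) ℝ) :
    ‖sampleCovariance x - S‖ = (1 / (n : ℝ)) *
      ‖∑ k, rankOne ℝ (x k) (x k) - (n : ℝ) • Matrix.toEuclideanCLM (𝕜 := ℝ) S‖ := by
  have hn' : (n : ℝ) ≠ 0 := Nat.cast_ne_zero.2 hn
  have h : Matrix.toEuclideanCLM (𝕜 := ℝ) (sampleCovariance x - S) = (1 / (n : ℝ)) •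
      (∑ k, rankOne ℝ (x k) (x k) - (n : ℝ) • Matrix.toEuclideanCLM (𝕜 := ℝ) S) := by
    simp only [sampleCovariance, map_sub, map_smul, map_sum, toEuclideanCLM_vecMulVec, smul_sub,
      smul_smul]
    rw [one_div_mul_cancel hn', one_smul]
  rw [← Matrix.l2_opNorm_toEuclideanCLM, h, norm_smul, Real.norm_of_nonneg (by positivity)]

lemma integral_inner_mul_inner_multivariateGaussian {S : Matrix (Fin d) (Fin d) ℝ}
    (hS : S.PosSemidef) (u v : EuclideanSpace ℝ (Fin d)) :
    ∫ x, ⟪u, x⟫ * ⟪v, x⟫ ∂(multivariateGaussian 0 S) =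
      ⟪u, Matrix.toEuclideanCLM (𝕜 := ℝ) S v⟫ := by
  have h := covarianceBilin_multivariateGaussian (μ := 0) hS u v
  rw [covarianceBilin_apply_eq_cov IsGaussian.memLp_two_id, covariance_eq_sub
    (memLp_inner_of_isGaussian _ u) (memLp_inner_of_isGaussian _ v),
    integral_inner_of_integral_eq_zero integral_id_multivariateGaussian] at h
  simp only [Pi.mul_apply, zero_mul, sub_zero] at h
  rw [h, Matrix.inner_toEuclideanCLM]

lemma integral_norm_sq_multivariateGaussian {S : Matrix (Fin d) (Fin d) ℝ}
    (hS : S.PosSemidef) : ∫ x, ‖x‖ ^ 2 ∂(multivariateGaussian 0 S) = S.trace := by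
  simp_rw [← (EuclideanSpace.basisFun (Fin d) ℝ).sum_sq_inner_right]
  rw [integral_finsetSum _ fun j _ => integrable_inner_sq_of_isGaussian _ _]
  refine Finset.sum_congr rfl fun j _ => ?_
  simp_rw [sq, integral_inner_mul_inner_multivariateGaussian hS, Matrix.inner_toEuclideanCLM]
  simp

end SampleCovariance

theorem mainTheorem9 :
    ∃ c C : ℝ, 0 < c ∧ 0 < C ∧
      ∀ (d n : ℕ) (_ : 1 ≤ n) (S : Matrix (Fin d) (Fin d) ℝ) (_ : S.PosSemidef)
        (Ω : Type*) [MeasurableSpace Ω] (P : MeasureTheory.Measure Ω)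
        [MeasureTheory.IsProbabilityMeasure P]
        (X : Fin n → Ω → EuclideanSpace ℝ (Fin d))
        (_ : ∀ k, ProbabilityTheory.HasLaw (X k) (ProbabilityTheory.multivariateGaussian 0 S) P)
        (_ : ProbabilityTheory.iIndepFun X P),
        MeasureTheory.Integrable (fun ω => ‖sampleCovariance (fun k => X k ω) - S‖) P ∧
        c * (‖S‖ * (√(effectiveRank S / n) + effectiveRank S / n)) ≤
            ∫ ω, ‖sampleCovariance (fun k => X k ω) - S‖ ∂P ∧
        ∫ ω, ‖sampleCovariance (fun k => X k ω) - S‖ ∂P ≤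
            C * (‖S‖ * (√(effectiveRank S / n) + effectiveRank S / n)) := by
  refine ⟨1 / 54, 12, by norm_num, by norm_num, ?_⟩
  intro d n hn S hS Ω _ P _ X hX hind
  have hn0 : (0 : ℝ) < n := by exact_mod_cast hn
  have : Nonempty (Fin n) := ⟨⟨0, hn⟩⟩
  set μ := multivariateGaussian 0 S with hμdef
  have hμ : ∫ x, x ∂μ = 0 := integral_id_multivariateGaussian
  set Q := Matrix.toEuclideanCLM (𝕜 := ℝ) S with hQdef
  have hQS : ‖Q‖ = ‖S‖ := Matrix.l2_opNorm_toEuclideanCLM S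
  have hQ := integral_inner_mul_inner_multivariateGaussian hS
  have htr := integral_norm_sq_multivariateGaussian hS
  rw [← hQdef, ← hμdef] at hQ
  rw [← hμdef] at htr
  have hXm : AEMeasurable (fun ω k => X k ω) P :=
    aemeasurable_pi_lambda _ fun k => (hX k).aemeasurable
  have hmap : P.map (fun ω k => X k ω) = Measure.pi fun _ : Fin n => μ := by
    rw [(iIndepFun_iff_map_fun_eq_pi_map fun k => (hX k).aemeasurable).1 hind]
    congr 1
    ext1 k
    exact (hX k).map_eq
  let φ : (Fin n → EuclideanSpace ℝ (Fin d)) → ℝ := fun x =>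
    ‖∑ k, rankOne ℝ (x k) (x k) - (n : ℝ) • Q‖
  have hφ : Integrable φ (Measure.pi fun _ : Fin n => μ) :=
    ((integrable_sum_rankOne_self μ).sub (integrable_const _)).norm
  have hφP : Integrable (fun ω => φ fun k => X k ω) P := by
    rw [← hmap] at hφ
    exact hφ.comp_aemeasurable hXm
  have hφint : ∫ ω, φ (fun k => X k ω) ∂P = ∫ x, φ x ∂(Measure.pi fun _ : Fin n => μ) := by
    rw [← hmap] at hφ ⊢
    exact (integral_map hXm hφ.1).symm
  simp_rw [norm_sampleCovariance_sub (Nat.one_le_iff_ne_zero.1 hn)]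
  refine ⟨hφP.const_mul _, ?_⟩
  rw [integral_const_mul]
  change _ ≤ 1 / (n : ℝ) * ∫ ω, φ (fun k => X k ω) ∂P ∧
    1 / (n : ℝ) * ∫ ω, φ (fun k => X k ω) ∂P ≤ _
  rw [hφint]
  have hU := integral_norm_sum_rankOne_sub_le (ι := Fin n) hμ hQ
  have hL := le_integral_norm_sum_rankOne_sub (ι := Fin n) hμ hQ
  have hL' := integral_norm_sq_sub_le (ι := Fin n) (μ := μ) Q
  rw [Fintype.card_fin, htr, hQS] at hU hL hL'
  change ∫ x, φ x ∂_ ≤ _ at hU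
  change _ ≤ 18 * ∫ x, φ x ∂_ at hL
  change _ ≤ ∫ x, φ x ∂_ at hL'
  set I := ∫ x, φ x ∂(Measure.pi fun _ : Fin n => μ)
  have hI0 : 0 ≤ I := integral_nonneg fun x => norm_nonneg _
  have ht : 0 ≤ S.trace := hS.trace_nonneg
  set t := S.trace with htdef
  set s := ‖S‖ with hsdef
  -- If `S = 0` (in particular if `d = 0`), the upper bound forces `I = 0` and every term vanishes.
  rcases (norm_nonneg S).eq_or_lt with hs | hs
  · have hS0 : S = 0 := norm_eq_zero.1 hs.symm
    have ht0 : t = 0 := by simp [htdef, hS0]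
    rw [← hsdef] at hs
    rw [ht0, ← hs] at hU
    have : I = 0 := le_antisymm (by simpa using hU) hI0
    rw [← hs, this]
    simp
  rw [← hsdef] at hs
  have hdec : s * (√(effectiveRank S / n) + effectiveRank S / n) =
      1 / n * (√s * √(n * t) + t) := by
    have h1 : effectiveRank S = t / s := rfl
    have h2 : √s * √(n * t) = s * n * √(t / s / n) := by
      rw [← Real.sqrt_mul hs.le, show s * (n * t) = (s * n) ^ 2 * (t / s / n) by field_simp,
        Real.sqrt_mul (by positivity), Real.sqrt_sq (by positivity)]
    rw [h1, h2]
    field_simp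
  rw [hdec]
  have hsq : (√s * √(n * t)) ^ 2 = n * s * t := by
    rw [mul_pow, Real.sq_sqrt hs.le, Real.sq_sqrt (by positivity)]
    ring
  have hw : 0 ≤ √s * √(n * t) := by positivity
  constructor
  · have : √s * √(n * t) + t ≤ 54 * I := by
      -- For `t ≤ 2 n s`, `t² ≤ 2 n s t` makes `t` at most twice the fluctuation term, hence `3 * 18
      -- = 54`. Otherwise `t - n s ≥ t / 2`, so `t ≤ 2 * I`.
      rcases le_total t (2 * (n * s)) with h | h
      · have : t ≤ 2 * (√s * √(n * t)) := by
          refine le_of_sq_le_sq ?_ (by positivity)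
          rw [mul_pow, hsq]
          nlinarith
        linarith
      · linarith
    have h2 : 1 / (n : ℝ) * (√s * √(n * t) + t) ≤ 1 / n * (54 * I) := by gcongr
    linarith
  · have : 1 / (n : ℝ) * I ≤ 1 / n * (12 * (√s * √(n * t) + t)) := by
      gcongr
      linarith
    linarith
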